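/- Let $n\ge 1$ and let $\Omega\subset\mathbb R^n$ be a bounded open set with $\mathcal L^n(\partial\Omega)=0$. Denote by $\dot{\mathrm{BV}}(\Omega)$ the space of all $v\in L^1_{\mathrm{loc}}(\Omega)$ with $$\sup\Big\{\int_\Omega v\,\mathrm{div}\,\varphi\,dx:\ \varphi\in C^1_c(\Omega;\mathbb R^n),\ |\varphi|\le 1\Big\}<\infty .$$ For $v\in\dot{\mathrm{BV}}(\Omega)$ let $Dv$ be its weak derivative, a finite $\mathbb R^n$-valued Radon measure on $\Omega$ with total variation measure $|Dv|$, and let $Dv=\nabla v\,\mathcal L^n+D^sv$ be its Lebesgue decomposition into absolutely continuous and singular parts with respect to $\mathcal L^n$. Put $$\int_\Omega E(Dv):=\int_\Omega\sqrt{1+|\nabla v|^2}\,dx+|D^sv|(\Omega).$$ Let $u\in\dot{\mathrm{BV}}(\Omega)$ and $\{u_\lambda\}_{\lambda>0}\subset\dot{\mathrm{BV}}(\Omega)$ be such that $u_\lambda\to u$ area-strictly in $\Omega$ as $\lambda\to\infty$, that is, $u_\lambda\to u$ in $L^1_{\mathrm{loc}}(\Omega)$ and $\int_\Omega E(Du_\lambda)\to\int_\Omega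 E(Du)$ as $\lambda\to\infty$. Then $$\limsup_{\lambda\to\infty}|D(u_\lambda-u)|(\Omega)\le 2\,|D^su|(\Omega).$$ -/

import Mathlib

open MeasureTheory Filter Topology
open scoped ENNReal

namespace HomBV

/-- The divergence of a vector field on `ℝⁿ`. -/
noncomputable def divergence {n : ℕ}
    (φ : EuclideanSpace ℝ (Fin n) → EuclideanSpace ℝ (Fin n)) (x : EuclideanSpace ℝ (Fin n)) : ℝ :=
  ∑ i, (fderiv ℝ φ x (EuclideanSpace.single i 1)) i

/-- `Var(u, Ω)`: the supremum of `∫_Ω u div φ` over all `φ ∈ C_c¹(Ω; ℝⁿ)` with `|φ| ≤ 1`.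
Since `φ` may be replaced by `-φ` or by `0`, taking the supremum of the nonnegative parts
gives the same element of `[0, ∞]`. -/
noncomputable def totalVar {n : ℕ} (Ω : Set (EuclideanSpace ℝ (Fin n)))
    (u : EuclideanSpace ℝ (Fin n) → ℝ) : ℝ≥0∞ :=
  ⨆ (φ : EuclideanSpace ℝ (Fin n) → EuclideanSpace ℝ (Fin n)) (_ : ContDiff ℝ 1 φ)
    (_ : HasCompactSupport φ) (_ : tsupport φ ⊆ Ω) (_ : ∀ x, ‖φ x‖ ≤ 1),
    ENNReal.ofReal (∫ x in Ω, u x * divergence φ x)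

/-- The homogeneous space `BV-dot(Ω)`: functions in `L¹_loc(Ω)` with `Var(u, Ω) < ∞`.
The values of `u` outside `Ω` play no role. -/
def BVDot {n : ℕ} (Ω : Set (EuclideanSpace ℝ (Fin n)))
    (u : EuclideanSpace ℝ (Fin n) → ℝ) : Prop :=
  LocallyIntegrableOn u Ω volume ∧ totalVar Ω u < ∞

/-- The `k`-th component of an `ℝⁿ`-valued measure. -/
noncomputable def component {n : ℕ}
    (μ : VectorMeasure (EuclideanSpace ℝ (Fin n)) (EuclideanSpace ℝ (Fin n))) (k : Fin n) :
    SignedMeasure (EuclideanSpace ℝ (Fin n)) where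
  measureOf' s := μ s k
  empty' := by simp
  not_measurable' s hs := by simp [μ.not_measurable hs]
  m_iUnion' f hf hd :=
    (EuclideanSpace.proj k : EuclideanSpace ℝ (Fin n) →L[ℝ] ℝ).hasSum (μ.m_iUnion hf hd)

theorem component_apply {n : ℕ}
    (μ : VectorMeasure (EuclideanSpace ℝ (Fin n)) (EuclideanSpace ℝ (Fin n))) (k : Fin n)
    (s : Set (EuclideanSpace ℝ (Fin n))) : component μ k s = μ s k :=
  rfl

/-- The finite `ℝⁿ`-valued measure `μ` is the weak derivative of `u` in `Ω`. A measure on `Ω` is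
regarded as a measure on `ℝⁿ` that does not charge the complement of `Ω`. -/
def IsWeakDeriv {n : ℕ} (Ω : Set (EuclideanSpace ℝ (Fin n)))
    (u : EuclideanSpace ℝ (Fin n) → ℝ)
    (μ : VectorMeasure (EuclideanSpace ℝ (Fin n)) (EuclideanSpace ℝ (Fin n))) : Prop :=
  μ.variation Ωᶜ = 0 ∧
    ∀ φ : EuclideanSpace ℝ (Fin n) → ℝ, ContDiff ℝ 1 φ → HasCompactSupport φ → tsupport φ ⊆ Ω →
      ∀ k : Fin n,
        ∫ x in Ω, u x * fderiv ℝ φ x (EuclideanSpace.single k 1)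
          = -∫ᵛ x, φ x ∂•(component μ k)

open Classical in
/-- The measure `Du` on `Ω`; it exists and is unique for every `u` in `BV-dot(Ω)`. -/
noncomputable def weakDeriv {n : ℕ} (Ω : Set (EuclideanSpace ℝ (Fin n)))
    (u : EuclideanSpace ℝ (Fin n) → ℝ) :
    VectorMeasure (EuclideanSpace ℝ (Fin n)) (EuclideanSpace ℝ (Fin n)) :=
  if h : ∃ μ, IsWeakDeriv Ω u μ then h.choose else 0

/-- `∇u`: the density of `Du` with respect to Lebesgue measure. -/
noncomputable def approxGrad {n : ℕ} (Ω : Set (EuclideanSpace ℝ (Fin n)))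
    (u : EuclideanSpace ℝ (Fin n) → ℝ) (x : EuclideanSpace ℝ (Fin n)) :
    EuclideanSpace ℝ (Fin n) :=
  WithLp.toLp 2 fun k => (component (weakDeriv Ω u) k).rnDeriv volume x

/-- `Dᵃu`: the absolutely continuous part of `Du` with respect to Lebesgue measure. -/
noncomputable def acDeriv {n : ℕ} (Ω : Set (EuclideanSpace ℝ (Fin n)))
    (u : EuclideanSpace ℝ (Fin n) → ℝ) :
    VectorMeasure (EuclideanSpace ℝ (Fin n)) (EuclideanSpace ℝ (Fin n)) :=
  (volume : Measure (EuclideanSpace ℝ (Fin n))).withDensityᵥ (approxGrad Ω u)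

/-- `Dˢu = Du - Dᵃu`: the singular part of `Du` with respect to Lebesgue measure. -/
noncomputable def singDeriv {n : ℕ} (Ω : Set (EuclideanSpace ℝ (Fin n)))
    (u : EuclideanSpace ℝ (Fin n) → ℝ) :
    VectorMeasure (EuclideanSpace ℝ (Fin n)) (EuclideanSpace ℝ (Fin n)) :=
  weakDeriv Ω u - acDeriv Ω u

/-- `∫_Ω E(Dv) = ∫_Ω E(∇v) dx + |Dˢv|(Ω)` with `E(z) = (1 + |z|²)^{1/2}`, for `v` in
`BV-dot(Ω)`. -/
noncomputable def areaIntegral {n : ℕ} (Ω : Set (EuclideanSpace ℝ (Fin n)))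
    (v : EuclideanSpace ℝ (Fin n) → ℝ) : ℝ≥0∞ :=
  (∫⁻ x in Ω, ENNReal.ofReal (Real.sqrt (1 + ‖approxGrad Ω v x‖ ^ 2)))
    + (singDeriv Ω v).variation Ω

/-- `u_t → u` in `L¹_loc(Ω)` as `t → ∞`. -/
def TendstoL1loc {n : ℕ} (Ω : Set (EuclideanSpace ℝ (Fin n)))
    (U : ℝ → EuclideanSpace ℝ (Fin n) → ℝ) (u : EuclideanSpace ℝ (Fin n) → ℝ) : Prop :=
  ∀ K : Set (EuclideanSpace ℝ (Fin n)), IsCompact K → K ⊆ Ω →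
    Tendsto (fun t => ∫⁻ x in K, ‖U t x - u x‖ₑ) atTop (𝓝 0)

/-- `u_t → u` area-strictly in `Ω` as `t → ∞`. -/
def TendstoAreaStrictly {n : ℕ} (Ω : Set (EuclideanSpace ℝ (Fin n)))
    (U : ℝ → EuclideanSpace ℝ (Fin n) → ℝ) (u : EuclideanSpace ℝ (Fin n) → ℝ) : Prop :=
  TendstoL1loc Ω U u ∧
    Tendsto (fun t => areaIntegral Ω (U t)) atTop (𝓝 (areaIntegral Ω u))

end HomBV

/-!
Write `E(p) = √(1 + |p|²)`. The number `∫_Ω E(Dv)` is the total variation of the `ℝ × ℝⁿ`-valued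
measure `(ℒⁿ, Dv)`, so it is the supremum of `∫_Ω √(1 - |g|²) dx + ∫ g · dDv` over the test fields
`g ∈ C_c¹(Ω; ℝⁿ)` with `|g| ≤ 1`; only the existence of almost optimal fields for `u` is needed
(`exists_area_test_field`). Fix such a `g`. By convergence in `L¹_loc`, `∫ g · dDu_t → ∫ g · dDu`
(`tendsto_pairing`), while the same `g` bounds `(Du_t + Du) / 2` from below in area
(`test_field_le`). Since the singular parts enter these bounds only through `|Dˢu_t| + |Dˢu|`,
convergence of the areas forces
`∫_Ω (E(∇u_t) + E(∇u) - 2 E((∇u_t + ∇u) / 2)) dx → 0` (`eventually_integral_areaDefect_le`).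

The integrand `E` is strictly convex, uniformly where `E(∇u)` is bounded. Hence the excess
`|p - q| - E(p) + E(q)` is at most a small constant plus a multiple of the convexity defect
(`exists_excess_le`), and
`∫_Ω (|∇u_t - ∇u| - E(∇u_t) + E(∇u)) dx` is asymptotically at most zero (`eventually_excess_le`).
The large values of `∇u` contribute little because the excess never exceeds `2 E(∇u)`.

By linearity of the weak derivative (`weakDeriv_sub`),
`|D(u_t - u)|(Ω) ≤ ∫_Ω |∇u_t - ∇u| dx + |Dˢu_t|(Ω) + |Dˢu|(Ω)`, so the last estimate bounds the left
side by `∫_Ω E(Du_t) - ∫_Ω E(∇u) dx + |Dˢu|(Ω) + o(1)`, which tends to `2 |Dˢu|(Ω)`.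

That `Du` exists for every function of finite variation (`exists_isWeakDeriv`) follows from the
Hahn–Banach theorem and the Riesz–Markov–Kakutani theorem. The latter is available for positive
functionals only and is applied to `|F|` and `|F| - F`, where `|F|(f) = sup {F φ : |φ| ≤ f}`.
-/

namespace HomBV

/-! ### Integration against `ℝⁿ`-valued measures -/

section VectorMeasures

/-- Integration against the signed measure of a positive measure is the Bochner integral. -/
theorem integral_toSignedMeasure_smul {X : Type*} [MeasurableSpace X] {φ : X → ℝ}
    (hφ : Measurable φ) {C : ℝ} (hC : ∀ x, |φ x| ≤ C) (μ : Measure X) [IsFiniteMeasure μ] :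
    μ.toSignedMeasure.Integrable φ ∧ ∫ᵛ x, φ x ∂•μ.toSignedMeasure = ∫ x, φ x ∂μ := by
  constructor
  · rw [VectorMeasure.Integrable, Measure.variation_toSignedMeasure]
    exact Integrable.of_bound hφ.aestronglyMeasurable C (ae_of_all _ hC)
  · rw [← VectorMeasure.integral_toSignedMeasure]
    congr 1
    ext
    simp

/-- Integration against the signed measure `f m` is integration of `φ * f` against `m`. -/
theorem integral_withDensityᵥ {X : Type*} [MeasurableSpace X] {m : Measure X} {f φ : X → ℝ}
    (hf : Integrable f m) (hφ : Measurable φ) {C : ℝ} (hC : ∀ x, |φ x| ≤ C) :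
    ∫ᵛ x, φ x ∂•(m.withDensityᵥ f) = ∫ x, φ x * f x ∂m := by
  have h1 := @integral_toSignedMeasure_smul X _ φ hφ C hC _
    (isFiniteMeasure_withDensity_ofReal hf.2)
  have h2 := @integral_toSignedMeasure_smul X _ φ hφ C hC
    (m.withDensity fun x => ENNReal.ofReal (-f x))
    (isFiniteMeasure_withDensity_ofReal hf.neg.2)
  have hb : ∀ s : X → ℝ, Integrable s m →
      ∫ x, φ x ∂(m.withDensity fun x => ENNReal.ofReal (s x)) = ∫ x, φ x * max (s x) 0 ∂m := by
    intro s hs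
    rw [integral_withDensity_eq_integral_toReal_smul₀ hs.1.aemeasurable.ennreal_ofReal
      (by simp)]
    refine integral_congr_ae (ae_of_all _ fun x => ?_)
    simp [ENNReal.toReal_ofReal', mul_comm]
  rw [withDensityᵥ_eq_withDensity_pos_part_sub_withDensity_neg_part hf,
    VectorMeasure.integral_sub_vectorMeasure h1.1 h2.1, h1.2, h2.2, hb f hf,
    hb (fun x => -f x) hf.neg, ← integral_sub]
  · refine integral_congr_ae (ae_of_all _ fun x => ?_)
    simp only
    rcases le_total 0 (f x) with h | h
    · simp [h]
    · simp [h]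
  · exact (hf.pos_part).bdd_mul hφ.aestronglyMeasurable (ae_of_all _ hC)
  · exact (hf.neg.pos_part).bdd_mul hφ.aestronglyMeasurable (ae_of_all _ hC)

variable {n : ℕ}

theorem component_withDensityᵥ {m : Measure (EuclideanSpace ℝ (Fin n))}
    {f : EuclideanSpace ℝ (Fin n) → EuclideanSpace ℝ (Fin n)} (hf : Integrable f m) (k : Fin n) :
    component (m.withDensityᵥ f) k = m.withDensityᵥ fun x => f x k := by
  have hk : Integrable (fun x => f x k) m :=
    (EuclideanSpace.proj k : EuclideanSpace ℝ (Fin n) →L[ℝ] ℝ).integrable_comp hf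
  ext s hs
  rw [component_apply, withDensityᵥ_apply hf hs, withDensityᵥ_apply hk hs]
  exact ((EuclideanSpace.proj k : EuclideanSpace ℝ (Fin n) →L[ℝ] ℝ).integral_comp_comm
    hf.integrableOn).symm

theorem ext_component {μ ν : VectorMeasure (EuclideanSpace ℝ (Fin n)) (EuclideanSpace ℝ (Fin n))}
    (h : ∀ k, component μ k = component ν k) : μ = ν := by
  ext s hs k
  simpa [component_apply] using congrArg (fun κ => κ s) (h k)

/-- A finite positive measure dominating an `ℝⁿ`-valued measure: the sum of the total variations
of its components. -/
noncomputable def dominating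
    (μ : VectorMeasure (EuclideanSpace ℝ (Fin n)) (EuclideanSpace ℝ (Fin n))) :
    Measure (EuclideanSpace ℝ (Fin n)) :=
  ∑ k, (component μ k).totalVariation

instance (μ : VectorMeasure (EuclideanSpace ℝ (Fin n)) (EuclideanSpace ℝ (Fin n))) :
    IsFiniteMeasure (dominating μ) := by
  unfold dominating
  have (k : Fin n) : IsFiniteMeasure (component μ k).totalVariation := by
    unfold SignedMeasure.totalVariation
    infer_instance
  infer_instance

theorem variation_component_le
    (μ : VectorMeasure (EuclideanSpace ℝ (Fin n)) (EuclideanSpace ℝ (Fin n))) (k : Fin n) :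
    (component μ k).variation ≤ μ.variation := by
  refine VectorMeasure.variation_le_of_forall_enorm_le fun s _ => ?_
  refine le_trans ?_ (μ.enorm_measure_le_variation s)
  rw [component_apply, enorm_le_iff_norm_le]
  exact PiLp.norm_apply_le (μ s) k

theorem dominating_le
    (μ : VectorMeasure (EuclideanSpace ℝ (Fin n)) (EuclideanSpace ℝ (Fin n)))
    (s : Set (EuclideanSpace ℝ (Fin n))) :
    dominating μ s ≤ n * μ.variation s := by
  simp only [dominating, Measure.finsetSum_apply, SignedMeasure.totalVariation_eq_variation]
  refine (Finset.sum_le_sum fun k _ => variation_component_le μ k s).trans ?_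
  simp

/-- Radon–Nikodym theorem for `ℝⁿ`-valued measures. -/
theorem exists_density
    (μ : VectorMeasure (EuclideanSpace ℝ (Fin n)) (EuclideanSpace ℝ (Fin n))) :
    ∃ f, Integrable f (dominating μ) ∧ (dominating μ).withDensityᵥ f = μ := by
  have hk : ∀ k, (dominating μ).withDensityᵥ ((component μ k).rnDeriv (dominating μ))
      = component μ k := by
    intro k
    refine SignedMeasure.withDensityᵥ_rnDeriv_eq _ _ ?_
    refine VectorMeasure.AbsolutelyContinuous.mk fun s hs h0 => ?_
    rw [Measure.toENNRealVectorMeasure_apply_measurable hs, dominating,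
      Measure.finsetSum_apply, Finset.sum_eq_zero_iff] at h0
    have := (component μ k).enorm_le_totalVariation s
    simpa [h0 k (Finset.mem_univ k)] using this
  have hint : Integrable (fun x => WithLp.toLp 2 fun k =>
      (component μ k).rnDeriv (dominating μ) x) (dominating μ) :=
    Integrable.of_eval_piLp fun k => SignedMeasure.integrable_rnDeriv _ _
  refine ⟨_, hint, ext_component fun k => ?_⟩
  rw [component_withDensityᵥ hint]
  exact hk k

instance (μ : VectorMeasure (EuclideanSpace ℝ (Fin n)) (EuclideanSpace ℝ (Fin n))) :
    IsFiniteMeasure μ.variation := by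
  obtain ⟨f, hf, h⟩ := exists_density μ
  rw [← h, Measure.variation_withDensityᵥ hf]
  exact isFiniteMeasure_withDensity hf.2.ne

theorem component_integrable
    (μ : VectorMeasure (EuclideanSpace ℝ (Fin n)) (EuclideanSpace ℝ (Fin n))) (k : Fin n)
    {φ : EuclideanSpace ℝ (Fin n) → ℝ} (hφ : Measurable φ) {C : ℝ} (hC : ∀ x, |φ x| ≤ C) :
    (component μ k).Integrable φ := by
  have : IsFiniteMeasure (component μ k).variation :=
    isFiniteMeasure_of_le _ (variation_component_le μ k)
  exact MeasureTheory.Integrable.of_bound hφ.aestronglyMeasurable C (ae_of_all _ hC)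

/-- The integral `∫ g · dμ` of a vector field `g` against an `ℝⁿ`-valued measure `μ`. -/
noncomputable def pairing (g : EuclideanSpace ℝ (Fin n) → EuclideanSpace ℝ (Fin n))
    (μ : VectorMeasure (EuclideanSpace ℝ (Fin n)) (EuclideanSpace ℝ (Fin n))) : ℝ :=
  ∑ k, ∫ᵛ x, g x k ∂•(component μ k)

theorem component_add (μ ν : VectorMeasure (EuclideanSpace ℝ (Fin n)) (EuclideanSpace ℝ (Fin n)))
    (k : Fin n) : component (μ + ν) k = component μ k + component ν k := by
  ext s hs
  simp [component_apply]

theorem component_sub (μ ν : VectorMeasure (EuclideanSpace ℝ (Fin n)) (EuclideanSpace ℝ (Fin n)))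
    (k : Fin n) : component (μ - ν) k = component μ k - component ν k := by
  ext s hs
  simp [component_apply]

variable {g : EuclideanSpace ℝ (Fin n) → EuclideanSpace ℝ (Fin n)}

theorem pairing_add (hg : Continuous g) (hg1 : ∀ x, ‖g x‖ ≤ 1)
    (μ ν : VectorMeasure (EuclideanSpace ℝ (Fin n)) (EuclideanSpace ℝ (Fin n))) :
    pairing g (μ + ν) = pairing g μ + pairing g ν := by
  have hm : ∀ k, Measurable fun x => g x k := fun k =>
    (by fun_prop : Continuous fun x => g x k).measurable
  have hb : ∀ k x, |g x k| ≤ 1 := fun k x => (PiLp.norm_apply_le (g x) k).trans (hg1 x)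
  simp only [pairing, component_add]
  rw [← Finset.sum_add_distrib]
  exact Finset.sum_congr rfl fun k _ => VectorMeasure.integral_add_vectorMeasure
    (component_integrable μ k (hm k) (hb k)) (component_integrable ν k (hm k) (hb k))

theorem pairing_withDensityᵥ (hg : Continuous g) (hg1 : ∀ x, ‖g x‖ ≤ 1)
    {m : Measure (EuclideanSpace ℝ (Fin n))}
    {f : EuclideanSpace ℝ (Fin n) → EuclideanSpace ℝ (Fin n)} (hf : Integrable f m) :
    pairing g (m.withDensityᵥ f) = ∫ x, inner ℝ (g x) (f x) ∂m := by
  have hm : ∀ k, Measurable fun x => g x k := fun k =>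
    (by fun_prop : Continuous fun x => g x k).measurable
  have hb : ∀ k x, |g x k| ≤ 1 := fun k x => (PiLp.norm_apply_le (g x) k).trans (hg1 x)
  have hk : ∀ k, Integrable (fun x => f x k) m := fun k =>
    (EuclideanSpace.proj k : EuclideanSpace ℝ (Fin n) →L[ℝ] ℝ).integrable_comp hf
  simp only [pairing, component_withDensityᵥ hf]
  simp_rw [integral_withDensityᵥ (hk _) (hm _) (hb _)]
  rw [← integral_finsetSum]
  · refine integral_congr_ae (ae_of_all _ fun x => ?_)
    simp [PiLp.inner_apply, mul_comm]
  · exact fun k _ => (hk k).bdd_mul (hm k).aestronglyMeasurable (ae_of_all _ (hb k))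

theorem integrable_inner_of_le_one (hg : Continuous g) (hg1 : ∀ x, ‖g x‖ ≤ 1)
    {m : Measure (EuclideanSpace ℝ (Fin n))}
    {f : EuclideanSpace ℝ (Fin n) → EuclideanSpace ℝ (Fin n)} (hf : Integrable f m) :
    Integrable (fun x => inner ℝ (g x) (f x)) m := by
  refine hf.norm.mono' (hg.aestronglyMeasurable.inner hf.1) (ae_of_all _ fun x => ?_)
  refine (norm_inner_le_norm _ _).trans ?_
  simpa using mul_le_mul_of_nonneg_right (hg1 x) (norm_nonneg (f x))

theorem variation_withDensityᵥ_toReal {m : Measure (EuclideanSpace ℝ (Fin n))}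
    {f : EuclideanSpace ℝ (Fin n) → EuclideanSpace ℝ (Fin n)} (hf : Integrable f m)
    {Ω : Set (EuclideanSpace ℝ (Fin n))} (hΩ : MeasurableSet Ω) :
    ((m.withDensityᵥ f).variation Ω).toReal = ∫ x in Ω, ‖f x‖ ∂m := by
  rw [Measure.variation_withDensityᵥ hf, withDensity_apply _ hΩ,
    integral_norm_eq_lintegral_enorm hf.1.restrict]

theorem pairing_withDensityᵥ_eq_setIntegral (hg : Continuous g) (hg1 : ∀ x, ‖g x‖ ≤ 1)
    {m : Measure (EuclideanSpace ℝ (Fin n))}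
    {f : EuclideanSpace ℝ (Fin n) → EuclideanSpace ℝ (Fin n)} (hf : Integrable f m)
    {Ω : Set (EuclideanSpace ℝ (Fin n))} (hs : tsupport g ⊆ Ω) :
    pairing g (m.withDensityᵥ f) = ∫ x in Ω, inner ℝ (g x) (f x) ∂m := by
  rw [pairing_withDensityᵥ hg hg1 hf]
  refine (setIntegral_eq_integral_of_forall_compl_eq_zero fun x hx => ?_).symm
  rw [image_eq_zero_of_notMem_tsupport fun h => hx (hs h), inner_zero_left]

/-- The total variation `|μ|(Ω)` dominates the pairing with fields bounded by one. -/
theorem pairing_le (hg : Continuous g) (hg1 : ∀ x, ‖g x‖ ≤ 1)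
    {Ω : Set (EuclideanSpace ℝ (Fin n))} (hΩ : MeasurableSet Ω) (hs : tsupport g ⊆ Ω)
    (μ : VectorMeasure (EuclideanSpace ℝ (Fin n)) (EuclideanSpace ℝ (Fin n))) :
    pairing g μ ≤ (μ.variation Ω).toReal := by
  obtain ⟨f, hf, h⟩ := exists_density μ
  conv_lhs => rw [← h]
  conv_rhs => rw [← h]
  rw [pairing_withDensityᵥ_eq_setIntegral hg hg1 hf hs, variation_withDensityᵥ_toReal hf hΩ]
  refine integral_mono (integrable_inner_of_le_one hg hg1 hf.integrableOn)
    hf.norm.integrableOn fun x => ?_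
  refine (real_inner_le_norm _ _).trans ?_
  simpa using mul_le_mul_of_nonneg_right (hg1 x) (norm_nonneg (f x))

end VectorMeasures

/-! ### Riesz representation of bounded functionals -/

section Riesz

open scoped NNReal CompactlySupported BoundedContinuousFunction

variable {X : Type*} [TopologicalSpace X]

/-- A compactly supported nonnegative function as a bounded real function. -/
noncomputable def toBdd (f : C_c(X, ℝ≥0)) : X →ᵇ ℝ :=
  f.toReal.toBoundedContinuousFunction

@[simp] theorem toBdd_apply (f : C_c(X, ℝ≥0)) (x : X) : toBdd f x = f x := by
  simp [toBdd]

/-- The values `F φ` for `|φ| ≤ f`; their supremum is the modulus `|F|` of `F` at `f`. -/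
def modulusSet (F : (X →ᵇ ℝ) →ₗ[ℝ] ℝ) (f : C_c(X, ℝ≥0)) : Set ℝ :=
  {r | ∃ φ : X →ᵇ ℝ, (∀ x, |φ x| ≤ f x) ∧ F φ = r}

variable {F : (X →ᵇ ℝ) →ₗ[ℝ] ℝ} {V : ℝ}

theorem zero_mem_modulusSet (f : C_c(X, ℝ≥0)) : 0 ∈ modulusSet F f :=
  ⟨0, by simp, by simp⟩

theorem le_of_mem_modulusSet (hV : 0 ≤ V) (hF : ∀ φ, |F φ| ≤ V * ‖φ‖) {f : C_c(X, ℝ≥0)} {M : ℝ}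
    (hM0 : 0 ≤ M) (hM : ∀ x, (f x : ℝ) ≤ M) {r : ℝ} (hr : r ∈ modulusSet F f) : r ≤ V * M := by
  obtain ⟨φ, hφ, rfl⟩ := hr
  refine (le_abs_self _).trans ((hF φ).trans ?_)
  gcongr
  exact (BoundedContinuousFunction.norm_le hM0).2 fun x => (hφ x).trans (hM x)

theorem bddAbove_modulusSet (hV : 0 ≤ V) (hF : ∀ φ, |F φ| ≤ V * ‖φ‖) (f : C_c(X, ℝ≥0)) :
    BddAbove (modulusSet F f) :=
  ⟨V * ‖toBdd f‖, fun _ hr => le_of_mem_modulusSet hV hF (norm_nonneg _)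
    (fun x => by simpa using (toBdd f).norm_coe_le_norm x) hr⟩

theorem sSup_modulusSet_nonneg (hV : 0 ≤ V) (hF : ∀ φ, |F φ| ≤ V * ‖φ‖) (f : C_c(X, ℝ≥0)) :
    0 ≤ sSup (modulusSet F f) :=
  le_csSup (bddAbove_modulusSet hV hF f) (zero_mem_modulusSet f)

/-- The modulus of a bounded functional is additive: a function bounded by `f + g` is cut at
height `f`, and the remainder is bounded by `g`. -/
theorem sSup_modulusSet_add (hV : 0 ≤ V) (hF : ∀ φ, |F φ| ≤ V * ‖φ‖) (f g : C_c(X, ℝ≥0)) :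
    sSup (modulusSet F (f + g)) = sSup (modulusSet F f) + sSup (modulusSet F g) := by
  apply le_antisymm
  · refine csSup_le ⟨0, zero_mem_modulusSet _⟩ ?_
    rintro _ ⟨φ, hφ, rfl⟩
    -- `ψ` is `φ` truncated to the interval `[-f, f]`.
    let ψ : X →ᵇ ℝ := (φ ⊓ toBdd f) ⊔ (-toBdd f)
    have hψ : ∀ x, ψ x = max (min (φ x) (f x)) (-(f x)) := fun x => by simp [ψ]
    have h1 : F ψ ∈ modulusSet F f := by
      refine ⟨ψ, fun x => ?_, rfl⟩
      rw [hψ, abs_le]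
      have := (f x).coe_nonneg
      exact ⟨le_max_right _ _, max_le (min_le_right _ _) (by linarith)⟩
    have h2 : F (φ - ψ) ∈ modulusSet F g := by
      refine ⟨φ - ψ, fun x => ?_, rfl⟩
      have h3 := hφ x
      have := (f x).coe_nonneg
      have := (g x).coe_nonneg
      simp only [BoundedContinuousFunction.coe_sub, Pi.sub_apply, hψ,
        CompactlySupportedContinuousMap.add_apply, NNReal.coe_add] at h3 ⊢
      rw [abs_le] at h3 ⊢
      rcases min_cases (φ x) (f x : ℝ) with h | h <;>
      rcases max_cases (min (φ x) (f x : ℝ)) (-(f x : ℝ)) with h' | h' <;>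
      constructor <;> linarith
    have : F φ = F ψ + F (φ - ψ) := by rw [← map_add]; congr 1; abel
    rw [this]
    exact add_le_add (le_csSup (bddAbove_modulusSet hV hF f) h1)
      (le_csSup (bddAbove_modulusSet hV hF g) h2)
  · rw [← le_sub_iff_add_le]
    refine csSup_le ⟨0, zero_mem_modulusSet _⟩ ?_
    rintro _ ⟨φ, hφ, rfl⟩
    rw [le_sub_comm]
    refine csSup_le ⟨0, zero_mem_modulusSet _⟩ ?_
    rintro _ ⟨ψ, hψ, rfl⟩
    rw [le_sub_iff_add_le', ← map_add]
    refine le_csSup (bddAbove_modulusSet hV hF _) ⟨φ + ψ, fun x => ?_, rfl⟩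
    simpa using (abs_add_le _ _).trans (add_le_add (hφ x) (hψ x))

theorem mul_sSup_modulusSet_le (hV : 0 ≤ V) (hF : ∀ φ, |F φ| ≤ V * ‖φ‖) (c : ℝ≥0)
    (f : C_c(X, ℝ≥0)) : c * sSup (modulusSet F f) ≤ sSup (modulusSet F (c • f)) := by
  rcases eq_or_lt_of_le (zero_le : 0 ≤ c) with rfl | hc
  · simpa using sSup_modulusSet_nonneg hV hF _
  have hc' : (0 : ℝ) < c := hc
  rw [mul_comm, ← le_div_iff₀ hc']
  refine csSup_le ⟨0, zero_mem_modulusSet _⟩ ?_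
  rintro _ ⟨φ, hφ, rfl⟩
  rw [le_div_iff₀ hc', mul_comm, ← smul_eq_mul, ← map_smul]
  refine le_csSup (bddAbove_modulusSet hV hF _) ⟨(c : ℝ) • φ, fun x => ?_, rfl⟩
  simpa [abs_mul] using mul_le_mul_of_nonneg_left (hφ x) hc'.le

theorem sSup_modulusSet_smul (hV : 0 ≤ V) (hF : ∀ φ, |F φ| ≤ V * ‖φ‖) (c : ℝ≥0)
    (f : C_c(X, ℝ≥0)) : sSup (modulusSet F (c • f)) = c * sSup (modulusSet F f) := by
  refine le_antisymm ?_ (mul_sSup_modulusSet_le hV hF c f)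
  rcases eq_or_ne c 0 with rfl | hc
  · have h2 := sSup_modulusSet_add hV hF (0 : C_c(X, ℝ≥0)) 0
    simp only [add_zero] at h2
    simp only [zero_smul, NNReal.coe_zero, zero_mul]
    linarith
  have := mul_sSup_modulusSet_le hV hF c⁻¹ (c • f)
  rw [smul_smul, inv_mul_cancel₀ hc, one_smul, NNReal.coe_inv,
    inv_mul_le_iff₀ (by positivity)] at this
  exact this

/-- The modulus `|F|` of a bounded functional, on nonnegative functions of compact support. -/
noncomputable def modulus (F : (X →ᵇ ℝ) →ₗ[ℝ] ℝ) (hV : 0 ≤ V) (hF : ∀ φ, |F φ| ≤ V * ‖φ‖) :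
    C_c(X, ℝ≥0) →ₗ[ℝ≥0] ℝ≥0 where
  toFun f := ⟨sSup (modulusSet F f), sSup_modulusSet_nonneg hV hF f⟩
  map_add' f g := NNReal.eq (sSup_modulusSet_add hV hF f g)
  map_smul' c f := NNReal.eq (sSup_modulusSet_smul hV hF c f)

theorem toBdd_add (f g : C_c(X, ℝ≥0)) : toBdd (f + g) = toBdd f + toBdd g := by
  ext x; simp

theorem toBdd_smul (c : ℝ≥0) (f : C_c(X, ℝ≥0)) : toBdd (c • f) = (c : ℝ) • toBdd f := by
  ext x; simp

theorem apply_toBdd_le (hV : 0 ≤ V) (hF : ∀ φ, |F φ| ≤ V * ‖φ‖) (f : C_c(X, ℝ≥0)) :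
    F (toBdd f) ≤ sSup (modulusSet F f) :=
  le_csSup (bddAbove_modulusSet hV hF f) ⟨toBdd f, fun x => by simp, rfl⟩

/-- The positive functional `|F| - F`. -/
noncomputable def modulusSub (F : (X →ᵇ ℝ) →ₗ[ℝ] ℝ) (hV : 0 ≤ V) (hF : ∀ φ, |F φ| ≤ V * ‖φ‖) :
    C_c(X, ℝ≥0) →ₗ[ℝ≥0] ℝ≥0 where
  toFun f := ⟨sSup (modulusSet F f) - F (toBdd f), sub_nonneg.2 (apply_toBdd_le hV hF f)⟩
  map_add' f g := NNReal.eq (by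
    change sSup (modulusSet F (f + g)) - F (toBdd (f + g)) =
      (sSup (modulusSet F f) - F (toBdd f)) + (sSup (modulusSet F g) - F (toBdd g))
    rw [sSup_modulusSet_add hV hF f g, toBdd_add, map_add]
    ring)
  map_smul' c f := NNReal.eq (by
    change sSup (modulusSet F (c • f)) - F (toBdd (c • f)) =
      c * (sSup (modulusSet F f) - F (toBdd f))
    rw [sSup_modulusSet_smul hV hF c f, toBdd_smul, map_smul, smul_eq_mul]
    ring)

variable [T2Space X] [LocallyCompactSpace X] [MeasurableSpace X] [BorelSpace X]

/-- A positive functional that is bounded on functions `≤ 1` is represented by a finite measure,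
by inner regularity of the space itself. -/
theorem isFiniteMeasure_rieszMeasure (Λ : C_c(X, ℝ≥0) →ₗ[ℝ≥0] ℝ≥0) (C : ℝ≥0)
    (h : ∀ f : C_c(X, ℝ≥0), (∀ x, f x ≤ 1) → Λ f ≤ C) :
    IsFiniteMeasure (NNRealRMK.rieszMeasure Λ) := by
  refine ⟨lt_of_le_of_lt ?_ (ENNReal.coe_lt_top (r := C))⟩
  rw [isOpen_univ.measure_eq_iSup_isCompact]
  refine iSup₂_le fun K _ => iSup_le fun hK => ?_
  obtain ⟨f, hf1, hfc, -, hf⟩ :=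
    exists_continuousMap_one_of_isCompact_subset_isOpen hK isOpen_univ (Set.subset_univ K)
  let g : C_c(X, ℝ≥0) := CompactlySupportedContinuousMap.nnrealPart ⟨f, hfc⟩
  have hg : ∀ x, g x ≤ 1 := fun x => Real.toNNReal_le_one.2 (hf x).2
  have hgK : ∀ x ∈ K, g x = 1 := fun x hx => Real.toNNReal_eq_one.2 (hf1 hx)
  calc NNRealRMK.rieszMeasure Λ K = ∫⁻ x in K, 1 ∂(NNRealRMK.rieszMeasure Λ) := by simp
    _ = ∫⁻ x in K, g x ∂(NNRealRMK.rieszMeasure Λ) :=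
      setLIntegral_congr_fun hK.measurableSet fun x hx => by simp [hgK x hx]
    _ ≤ ∫⁻ x, g x ∂(NNRealRMK.rieszMeasure Λ) := setLIntegral_le_lintegral _ _
    _ = Λ g := NNRealRMK.lintegral_rieszMeasure Λ g
    _ ≤ C := by exact_mod_cast h g hg

/-- Riesz representation of a bounded functional as a difference of finite measures. -/
theorem exists_measures_of_bounded (F : (X →ᵇ ℝ) →ₗ[ℝ] ℝ) (hV : 0 ≤ V)
    (hF : ∀ φ, |F φ| ≤ V * ‖φ‖) :
    ∃ μ ν : Measure X, IsFiniteMeasure μ ∧ IsFiniteMeasure ν ∧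
      ∀ φ : X →ᵇ ℝ, HasCompactSupport φ → F φ = ∫ x, φ x ∂μ - ∫ x, φ x ∂ν := by
  have hle : ∀ f : C_c(X, ℝ≥0), (∀ x, f x ≤ 1) → sSup (modulusSet F f) ≤ V := fun f hf =>
    csSup_le ⟨0, zero_mem_modulusSet f⟩ fun r hr => by
      simpa using le_of_mem_modulusSet hV hF zero_le_one (fun x => by exact_mod_cast hf x) hr
  have hμ : IsFiniteMeasure (NNRealRMK.rieszMeasure (modulus F hV hF)) :=
    isFiniteMeasure_rieszMeasure _ ⟨V, hV⟩ hle
  have hν : IsFiniteMeasure (NNRealRMK.rieszMeasure (modulusSub F hV hF)) := by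
    refine isFiniteMeasure_rieszMeasure _ ⟨2 * V, by positivity⟩ fun f hf => ?_
    refine NNReal.coe_le_coe.1 (?_ : sSup (modulusSet F f) - F (toBdd f) ≤ 2 * V)
    have h1 := hle f hf
    have h2 : -F (toBdd f) ≤ sSup (modulusSet F f) :=
      le_csSup (bddAbove_modulusSet hV hF f) ⟨-toBdd f, fun x => by simp, by simp⟩
    linarith
  refine ⟨_, _, hμ, hν, fun φ hφ => ?_⟩
  have key : ∀ f : C_c(X, ℝ≥0), F (toBdd f) =
      ∫ x, (f x : ℝ) ∂(NNRealRMK.rieszMeasure (modulus F hV hF)) -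
        ∫ x, (f x : ℝ) ∂(NNRealRMK.rieszMeasure (modulusSub F hV hF)) := by
    intro f
    rw [NNRealRMK.integral_rieszMeasure, NNRealRMK.integral_rieszMeasure]
    exact (sub_sub_cancel (sSup (modulusSet F f)) (F (toBdd f))).symm
  let ψ : C_c(X, ℝ) := ⟨φ.toContinuousMap, hφ⟩
  have hφψ : φ = toBdd ψ.nnrealPart - toBdd (-ψ).nnrealPart := by
    ext x
    simp only [BoundedContinuousFunction.coe_sub, Pi.sub_apply, toBdd_apply,
      CompactlySupportedContinuousMap.nnrealPart_apply,
      CompactlySupportedContinuousMap.neg_apply]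
    rw [Real.coe_toNNReal', Real.coe_toNNReal']
    change φ x = max (φ x) 0 - max (-φ x) 0
    rcases le_total 0 (φ x) with h | h <;> simp [h]
  have hi : ∀ (m : Measure X) [IsFiniteMeasure m] (f : C_c(X, ℝ≥0)),
      Integrable (fun x => (f x : ℝ)) m := fun m _ f =>
    ((toBdd f).integrable m).congr (ae_of_all _ (toBdd_apply f))
  have hsub : ∀ (m : Measure X) [IsFiniteMeasure m], ∫ x, φ x ∂m =
      ∫ x, (ψ.nnrealPart x : ℝ) ∂m - ∫ x, ((-ψ).nnrealPart x : ℝ) ∂m := by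
    intro m _
    rw [← integral_sub (hi m _) (hi m _)]
    refine integral_congr_ae (ae_of_all _ fun x => ?_)
    conv_lhs => rw [hφψ]
    simp
  rw [hsub, hsub]
  conv_lhs => rw [hφψ, map_sub, key, key]
  ring

end Riesz

/-! ### Existence, uniqueness and linearity of the weak derivative -/

section WeakDerivative

open scoped BoundedContinuousFunction

variable {n : ℕ} {Ω : Set (EuclideanSpace ℝ (Fin n))} {u v : EuclideanSpace ℝ (Fin n) → ℝ}

theorem integrable_mul_of_tsupport_subset (hu : LocallyIntegrableOn u Ω volume)
    {ψ : EuclideanSpace ℝ (Fin n) → ℝ} (hψ : Continuous ψ) (hc : HasCompactSupport ψ)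
    (hs : tsupport ψ ⊆ Ω) : IntegrableOn (fun x => u x * ψ x) Ω := by
  have h1 : IntegrableOn (fun x => u x * ψ x) (tsupport ψ) := by
    obtain ⟨C, hC⟩ := hc.exists_bound_of_continuous hψ
    exact (hu.integrableOn_compact_subset hs hc).mul_bdd hψ.aestronglyMeasurable (ae_of_all _ hC)
  refine Integrable.integrableOn ?_
  rwa [integrableOn_iff_integrable_of_support_subset] at h1
  exact (Function.support_mul_subset_right _ _).trans subset_closure

theorem continuous_fderiv_apply {F : Type*} [NormedAddCommGroup F] [NormedSpace ℝ F]
    {φ : EuclideanSpace ℝ (Fin n) → F} (hφ : ContDiff ℝ 1 φ) (e : EuclideanSpace ℝ (Fin n)) :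
    Continuous fun x => fderiv ℝ φ x e :=
  (hφ.continuous_fderiv one_ne_zero).clm_apply continuous_const

theorem integrable_mul_fderiv (hu : LocallyIntegrableOn u Ω volume)
    {φ : EuclideanSpace ℝ (Fin n) → ℝ} (hφ : ContDiff ℝ 1 φ) (hc : HasCompactSupport φ)
    (hs : tsupport φ ⊆ Ω) (e : EuclideanSpace ℝ (Fin n)) :
    IntegrableOn (fun x => u x * fderiv ℝ φ x e) Ω :=
  integrable_mul_of_tsupport_subset hu (continuous_fderiv_apply hφ e) (hc.fderiv_apply ℝ e)
    ((tsupport_fderiv_apply_subset ℝ e).trans hs)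

theorem divergence_eq {φ : EuclideanSpace ℝ (Fin n) → EuclideanSpace ℝ (Fin n)}
    (hφ : ContDiff ℝ 1 φ) (x : EuclideanSpace ℝ (Fin n)) :
    divergence φ x = ∑ k, fderiv ℝ (fun y => φ y k) x (EuclideanSpace.single k 1) := by
  refine Finset.sum_congr rfl fun k _ => ?_
  have h := ((EuclideanSpace.proj k : EuclideanSpace ℝ (Fin n) →L[ℝ] ℝ).hasFDerivAt.comp x
    ((hφ.differentiable one_ne_zero) x).hasFDerivAt).fderiv
  change _ = fderiv ℝ ((EuclideanSpace.proj k : EuclideanSpace ℝ (Fin n) →L[ℝ] ℝ) ∘ φ) x _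
  rw [h]
  simp

/-- The test functions `C_c¹(Ω)`, inside the bounded continuous functions. -/
def testFunctions (Ω : Set (EuclideanSpace ℝ (Fin n))) :
    Submodule ℝ (EuclideanSpace ℝ (Fin n) →ᵇ ℝ) where
  carrier := {φ | ContDiff ℝ 1 φ ∧ HasCompactSupport φ ∧ tsupport φ ⊆ Ω}
  add_mem' {φ ψ} hφ hψ :=
    ⟨hφ.1.add hψ.1, hφ.2.1.add hψ.2.1,
      (tsupport_add φ ψ).trans (Set.union_subset hφ.2.2 hψ.2.2)⟩
  zero_mem' := ⟨contDiff_const, HasCompactSupport.zero, by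
    simp [tsupport]⟩
  smul_mem' c φ hφ :=
    ⟨contDiff_const.smul hφ.1, hφ.2.1.smul_left (f := fun _ => c),
      (tsupport_smul_subset_right (fun _ => c) φ).trans hφ.2.2⟩

/-- The distributional partial derivative `φ ↦ -∫_Ω u ∂ₖφ`. -/
noncomputable def distribDeriv (hu : LocallyIntegrableOn u Ω volume) (k : Fin n) :
    Module.Dual ℝ (testFunctions Ω) where
  toFun φ := -∫ x in Ω, u x * fderiv ℝ φ.1 x (EuclideanSpace.single k 1)
  map_add' φ ψ := by
    rw [← neg_add, ← integral_add (integrable_mul_fderiv hu φ.2.1 φ.2.2.1 φ.2.2.2 _)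
      (integrable_mul_fderiv hu ψ.2.1 ψ.2.2.1 ψ.2.2.2 _)]
    congr 1
    refine integral_congr_ae (ae_of_all _ fun x => ?_)
    have := fderiv_add (𝕜 := ℝ) (φ.2.1.differentiable one_ne_zero x)
      (ψ.2.1.differentiable one_ne_zero x)
    change u x * fderiv ℝ (φ.1 + ψ.1 : EuclideanSpace ℝ (Fin n) → ℝ) x _ = _
    rw [this]
    simp [mul_add]
  map_smul' c φ := by
    rw [RingHom.id_apply, smul_eq_mul, mul_neg, ← integral_const_mul]
    congr 1
    refine integral_congr_ae (ae_of_all _ fun x => ?_)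
    have := fderiv_const_smul (𝕜 := ℝ) (φ.2.1.differentiable one_ne_zero x) c
    change u x * fderiv ℝ (c • φ.1 : EuclideanSpace ℝ (Fin n) → ℝ) x _ = _
    rw [this]
    simp only [_root_.smul_apply, smul_eq_mul]
    ring

/-- The distributional derivative is bounded in the sup norm by `Var(u, Ω)`: test the definition
of the latter with the field `-(φ / ‖φ‖) eₖ`. -/
theorem distribDeriv_le (hu : BVDot Ω u) (k : Fin n) (φ : testFunctions Ω) :
    distribDeriv hu.1 k φ ≤ (totalVar Ω u).toReal * ‖φ‖ := by
  rcases eq_or_ne φ 0 with rfl | h0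
  · simp
  have hpos : 0 < ‖φ‖ := by
    rw [Submodule.coe_norm]
    exact norm_pos_iff.2 fun h => h0 (Subtype.ext h)
  let Φ : EuclideanSpace ℝ (Fin n) → EuclideanSpace ℝ (Fin n) :=
    fun x => (-(‖φ‖⁻¹ * φ.1 x)) • EuclideanSpace.single k 1
  have hΦ : ContDiff ℝ 1 Φ := ((contDiff_const.mul φ.2.1).neg).smul contDiff_const
  have hsub : Function.support Φ ⊆ Function.support φ.1 := fun x hx h => hx (by simp [Φ, h])
  have hts : tsupport Φ ⊆ tsupport φ.1 := closure_mono hsub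
  have hdiv : ∀ x, divergence Φ x =
      -‖φ‖⁻¹ * fderiv ℝ φ.1 x (EuclideanSpace.single k 1) := by
    intro x
    have hd : HasFDerivAt Φ
        ((-(‖φ‖⁻¹ • fderiv ℝ φ.1 x)).smulRight (EuclideanSpace.single k (1 : ℝ))) x :=
      (((φ.2.1.differentiable one_ne_zero x).hasFDerivAt.const_mul _).neg).smul_const _
    simp [divergence, hd.fderiv]
  have hle : ENNReal.ofReal (∫ x in Ω, u x * divergence Φ x) ≤ totalVar Ω u := by
    refine le_iSup_of_le Φ <| le_iSup_of_le hΦ <|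
      le_iSup_of_le (φ.2.2.1.mono hsub) <| le_iSup_of_le (hts.trans φ.2.2.2) <|
      le_iSup_of_le (fun x => ?_) le_rfl
    have := φ.1.norm_coe_le_norm x
    simp only [Φ, norm_smul, norm_neg, norm_mul, norm_inv, norm_norm, PiLp.norm_single,
      norm_one, mul_one]
    rw [inv_mul_le_iff₀ hpos, mul_one]
    exact this
  have h1 := (ENNReal.ofReal_le_iff_le_toReal hu.2.ne).1 hle
  have h2 : ∫ x in Ω, u x * divergence Φ x = ‖φ‖⁻¹ * distribDeriv hu.1 k φ := by
    simp only [hdiv, distribDeriv, LinearMap.coe_mk, AddHom.coe_mk]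
    rw [mul_neg, ← integral_const_mul, ← integral_neg]
    exact integral_congr_ae (ae_of_all _ fun x => by simp only; ring)
  rw [h2, inv_mul_le_iff₀ hpos] at h1
  linarith

/-- The `ℝⁿ`-valued measure with given components. -/
noncomputable def ofComponents (s : Fin n → SignedMeasure (EuclideanSpace ℝ (Fin n))) :
    VectorMeasure (EuclideanSpace ℝ (Fin n)) (EuclideanSpace ℝ (Fin n)) where
  measureOf' A := WithLp.toLp 2 fun k => s k A
  empty' := by ext; simp
  not_measurable' A hA := by ext k; simp [(s k).not_measurable hA]
  m_iUnion' f hf hd := by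
    have : HasSum (fun i => fun k => s k (f i)) (fun k => s k (⋃ i, f i)) :=
      Pi.hasSum.2 fun k => (s k).m_iUnion hf hd
    exact (EuclideanSpace.equiv (Fin n) ℝ).symm.toContinuousLinearMap.hasSum this

/-- Existence of the weak derivative: Hahn–Banach extends each distributional partial derivative
to all bounded continuous functions, where it is represented by a difference of measures. -/
theorem exists_isWeakDeriv (hΩ : IsOpen Ω) (hu : BVDot Ω u) : ∃ μ, IsWeakDeriv Ω u μ := by
  set V := (totalVar Ω u).toReal
  have hV : 0 ≤ V := ENNReal.toReal_nonneg
  have key : ∀ k : Fin n, ∃ μ ν : Measure (EuclideanSpace ℝ (Fin n)),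
      ∃ (_ : IsFiniteMeasure μ) (_ : IsFiniteMeasure ν), ∀ φ : testFunctions Ω,
        distribDeriv hu.1 k φ = ∫ x, φ.1 x ∂μ - ∫ x, φ.1 x ∂ν := by
    intro k
    let p : Seminorm ℝ (EuclideanSpace ℝ (Fin n) →ᵇ ℝ) :=
      V.toNNReal • normSeminorm ℝ (EuclideanSpace ℝ (Fin n) →ᵇ ℝ)
    have hp : ∀ φ, p φ = V * ‖φ‖ := fun φ => by
      change (V.toNNReal : ℝ) * ‖φ‖ = _
      rw [Real.coe_toNNReal _ hV]
    obtain ⟨F, hF, hFV⟩ := Module.Dual.exists_extension_of_le_seminorm_real (testFunctions Ω)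
      (distribDeriv hu.1 k) (p := p) fun φ => (distribDeriv_le hu k φ).trans_eq (hp _).symm
    obtain ⟨μ, ν, hμ, hν, h⟩ := exists_measures_of_bounded F hV fun φ => (hFV φ).trans_eq (hp φ)
    exact ⟨μ, ν, hμ, hν, fun φ => by rw [← hF, h φ.1 φ.2.2.1]⟩
  choose μ ν hμ hν h using key
  let s : Fin n → SignedMeasure (EuclideanSpace ℝ (Fin n)) := fun k =>
    ((μ k).restrict Ω).toSignedMeasure - ((ν k).restrict Ω).toSignedMeasure
  -- Restricting to `Ω` does not affect test functions, which vanish outside `Ω`.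
  refine ⟨ofComponents s, ?_, fun φ hφ hc hs k => ?_⟩
  · rw [VectorMeasure.variation_apply_eq_zero hΩ.measurableSet.compl]
    intro t ht htm
    ext k
    have h0 : t ∩ Ω = ∅ := by
      rw [← Set.disjoint_iff_inter_eq_empty]
      exact Set.disjoint_left.2 fun x hx => ht hx
    change s k t = 0
    simp [s, Measure.toSignedMeasure_apply_measurable htm, measureReal_def,
      Measure.restrict_apply htm, h0]
  · obtain ⟨C, hC⟩ := hc.exists_bound_of_continuous hφ.continuous
    let ψ : EuclideanSpace ℝ (Fin n) →ᵇ ℝ :=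
      BoundedContinuousFunction.ofNormedAddCommGroup φ hφ.continuous C hC
    have hk := h k ⟨ψ, hφ, hc, hs⟩
    have hr : ∀ m : Measure (EuclideanSpace ℝ (Fin n)), ∫ x in Ω, φ x ∂m = ∫ x, φ x ∂m :=
      fun m => setIntegral_eq_integral_of_forall_compl_eq_zero fun x hx =>
        image_eq_zero_of_notMem_tsupport fun hx' => hx (hs hx')
    have h1 := integral_toSignedMeasure_smul hφ.continuous.measurable hC ((μ k).restrict Ω)
    have h2 := integral_toSignedMeasure_smul hφ.continuous.measurable hC ((ν k).restrict Ω)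
    change _ = -∫ᵛ x, φ x ∂•(s k)
    rw [VectorMeasure.integral_sub_vectorMeasure h1.1 h2.1, h1.2, h2.2, hr, hr,
      eq_neg_iff_add_eq_zero, add_comm, ← eq_neg_iff_add_eq_zero]
    exact hk.symm

theorem isWeakDeriv_weakDeriv (hΩ : IsOpen Ω) (hu : BVDot Ω u) :
    IsWeakDeriv Ω u (weakDeriv Ω u) := by
  have h := exists_isWeakDeriv hΩ hu
  rw [weakDeriv, dif_pos h]
  exact h.choose_spec

theorem IsWeakDeriv.sub (hu : LocallyIntegrableOn u Ω volume) (hv : LocallyIntegrableOn v Ω volume)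
    {μ ν : VectorMeasure (EuclideanSpace ℝ (Fin n)) (EuclideanSpace ℝ (Fin n))}
    (hμ : IsWeakDeriv Ω u μ) (hν : IsWeakDeriv Ω v ν) :
    IsWeakDeriv Ω (fun x => u x - v x) (μ - ν) := by
  refine ⟨?_, fun φ hφ hc hs k => ?_⟩
  · refine le_antisymm ((VectorMeasure.variation_sub_le (μ := μ) (ν := ν) Ωᶜ).trans ?_) zero_le
    simp [hμ.1, hν.1]
  · obtain ⟨C, hC⟩ := hc.exists_bound_of_continuous hφ.continuous
    have h1 := integrable_mul_fderiv hu hφ hc hs (EuclideanSpace.single k 1)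
    have h2 := integrable_mul_fderiv hv hφ hc hs (EuclideanSpace.single k 1)
    rw [component_sub, VectorMeasure.integral_sub_vectorMeasure
      (component_integrable μ k hφ.continuous.measurable hC)
      (component_integrable ν k hφ.continuous.measurable hC)]
    simp only [sub_mul]
    rw [integral_sub h1 h2, hμ.2 φ hφ hc hs k, hν.2 φ hφ hc hs k]
    ring

/-- Uniqueness of the weak derivative, in the form for the zero function: the density of `μ` with
respect to `dominating μ` vanishes, since all its integrals against test functions do. -/
theorem IsWeakDeriv.eq_zero (hΩ : IsOpen Ω)
    {μ : VectorMeasure (EuclideanSpace ℝ (Fin n)) (EuclideanSpace ℝ (Fin n))}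
    (hμ : IsWeakDeriv Ω (fun _ => 0) μ) : μ = 0 := by
  obtain ⟨f, hf, h⟩ := exists_density μ
  have hΩ0 : dominating μ Ωᶜ = 0 :=
    le_antisymm ((dominating_le μ _).trans (by simp [hμ.1])) zero_le
  refine ext_component fun k => ?_
  have hk : Integrable (fun x => f x k) (dominating μ) :=
    (EuclideanSpace.proj k : EuclideanSpace ℝ (Fin n) →L[ℝ] ℝ).integrable_comp hf
  have h0 : ∀ᵐ x ∂(dominating μ), x ∈ Ω → f x k = 0 := by
    refine hΩ.ae_eq_zero_of_integral_contDiff_smul_eq_zero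
      (hk.locallyIntegrable.locallyIntegrableOn _) fun φ hφ hc hs => ?_
    obtain ⟨C, hC⟩ := hc.exists_bound_of_continuous hφ.continuous
    have h1 := hμ.2 φ (hφ.of_le (by exact_mod_cast le_top)) hc hs k
    rw [← h, component_withDensityᵥ hf,
      integral_withDensityᵥ hk hφ.continuous.measurable hC] at h1
    simpa using h1
  have hae : (fun x => f x k) =ᵐ[dominating μ] 0 := by
    have : ∀ᵐ x ∂(dominating μ), x ∈ Ω := by
      rw [ae_iff]; exact hΩ0
    filter_upwards [h0, this] with x hx hx' using hx hx'
  conv_lhs => rw [← h]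
  rw [component_withDensityᵥ hf, WithDensityᵥEq.congr_ae hae, withDensityᵥ_zero]
  ext s hs
  simp [component_apply]

theorem IsWeakDeriv.unique (hΩ : IsOpen Ω) (hu : LocallyIntegrableOn u Ω volume)
    {μ ν : VectorMeasure (EuclideanSpace ℝ (Fin n)) (EuclideanSpace ℝ (Fin n))}
    (hμ : IsWeakDeriv Ω u μ) (hν : IsWeakDeriv Ω u ν) : μ = ν := by
  have := hμ.sub hu hu hν
  simp only [sub_self] at this
  exact sub_eq_zero.1 (this.eq_zero hΩ)

theorem weakDeriv_sub (hΩ : IsOpen Ω) (hu : BVDot Ω u) (hv : BVDot Ω v) :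
    weakDeriv Ω (fun x => u x - v x) = weakDeriv Ω u - weakDeriv Ω v := by
  have h := (isWeakDeriv_weakDeriv hΩ hu).sub hu.1 hv.1 (isWeakDeriv_weakDeriv hΩ hv)
  have hex : ∃ μ, IsWeakDeriv Ω (fun x => u x - v x) μ := ⟨_, h⟩
  rw [weakDeriv, dif_pos hex]
  exact hex.choose_spec.unique hΩ (hu.1.sub hv.1) h

/-- Integration by parts against a vector field. -/
theorem IsWeakDeriv.pairing_eq (hu : LocallyIntegrableOn u Ω volume)
    {μ : VectorMeasure (EuclideanSpace ℝ (Fin n)) (EuclideanSpace ℝ (Fin n))}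
    (hμ : IsWeakDeriv Ω u μ) {g : EuclideanSpace ℝ (Fin n) → EuclideanSpace ℝ (Fin n)}
    (hg : ContDiff ℝ 1 g) (hc : HasCompactSupport g) (hs : tsupport g ⊆ Ω) :
    pairing g μ = -∫ x in Ω, u x * divergence g x := by
  have hgk : ∀ k, ContDiff ℝ 1 fun x => g x k := fun k => by fun_prop
  have hsub : ∀ k, Function.support (fun x => g x k) ⊆ Function.support g :=
    fun k x hx h => hx (by simp [h])
  have hck : ∀ k, HasCompactSupport fun x => g x k := fun k => hc.mono (hsub k)
  have hsk : ∀ k, tsupport (fun x => g x k) ⊆ Ω := fun k => (closure_mono (hsub k)).trans hs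
  simp only [divergence_eq hg, Finset.mul_sum]
  rw [integral_finsetSum _ fun k _ => integrable_mul_fderiv hu (hgk k) (hck k) (hsk k) _,
    ← Finset.sum_neg_distrib]
  refine Finset.sum_congr rfl fun k _ => ?_
  rw [hμ.2 _ (hgk k) (hck k) (hsk k) k, neg_neg]

/-- Convergence in `L¹_loc` gives convergence of the derivatives against each fixed test field. -/
theorem tendsto_pairing (hΩ : IsOpen Ω) {U : ℝ → EuclideanSpace ℝ (Fin n) → ℝ}
    (hU : ∀ t : ℝ, 0 < t → BVDot Ω (U t)) (hu : BVDot Ω u) (hconv : TendstoL1loc Ω U u)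
    {g : EuclideanSpace ℝ (Fin n) → EuclideanSpace ℝ (Fin n)}
    (hg : ContDiff ℝ 1 g) (hc : HasCompactSupport g) (hs : tsupport g ⊆ Ω) :
    Tendsto (fun t => pairing g (weakDeriv Ω (U t))) atTop (𝓝 (pairing g (weakDeriv Ω u))) := by
  have hdc : Continuous (divergence g) := by
    unfold divergence
    refine continuous_finsetSum _ fun k _ => ?_
    have := continuous_fderiv_apply hg (EuclideanSpace.single k 1)
    fun_prop
  have hsupp : Function.support (divergence g) ⊆ tsupport g := by
    intro x hx
    by_contra h
    refine hx ?_
    have : fderiv ℝ g x = 0 := image_eq_zero_of_notMem_tsupport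
      fun h' => h (tsupport_fderiv_subset ℝ h')
    simp [divergence, this]
  have hts : tsupport (divergence g) ⊆ tsupport g := closure_minimal hsupp (isClosed_tsupport g)
  have hdcs : HasCompactSupport (divergence g) := hc.of_isClosed_subset (isClosed_tsupport _) hts
  obtain ⟨C, hC⟩ := hdcs.exists_bound_of_continuous hdc
  have hC0 : 0 ≤ C := (norm_nonneg _).trans (hC 0)
  have hint : ∀ w, LocallyIntegrableOn w Ω volume →
      IntegrableOn (fun x => w x * divergence g x) Ω := fun w hw =>
    integrable_mul_of_tsupport_subset hw hdc hdcs (hts.trans hs)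
  have hlim := (ENNReal.tendsto_toReal ENNReal.zero_ne_top).comp
    (hconv (tsupport g) hc hs)
  rw [tendsto_iff_dist_tendsto_zero]
  refine squeeze_zero' (Eventually.of_forall fun _ => dist_nonneg) ?_
    (by simpa using hlim.const_mul C)
  filter_upwards [eventually_gt_atTop 0] with t ht
  have hd : LocallyIntegrableOn (fun x => U t x - u x) Ω volume := (hU t ht).1.sub hu.1
  rw [(isWeakDeriv_weakDeriv hΩ (hU t ht)).pairing_eq (hU t ht).1 hg hc hs,
    (isWeakDeriv_weakDeriv hΩ hu).pairing_eq hu.1 hg hc hs, dist_neg_neg, Real.dist_eq,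
    ← integral_sub (hint _ (hU t ht).1) (hint _ hu.1)]
  have hK : IntegrableOn (fun x => U t x - u x) (tsupport g) :=
    hd.integrableOn_compact_subset hs hc
  calc |∫ x in Ω, (U t x * divergence g x - u x * divergence g x)|
      = |∫ x in tsupport g, (U t x - u x) * divergence g x| := by
        simp_rw [← sub_mul]
        congr 1
        refine setIntegral_eq_of_subset_of_forall_sdiff_eq_zero hΩ.measurableSet hs fun x hx => ?_
        have : divergence g x = 0 := by
          by_contra h; exact hx.2 (hsupp h)
        simp [this]
    _ ≤ ∫ x in tsupport g, C * ‖U t x - u x‖ := by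
        rw [← Real.norm_eq_abs]
        refine norm_integral_le_of_norm_le (hK.norm.const_mul C) (ae_of_all _ fun x => ?_)
        rw [norm_mul, mul_comm]
        exact mul_le_mul_of_nonneg_right (hC x) (norm_nonneg _)
    _ = C * (∫⁻ x in tsupport g, ‖U t x - u x‖ₑ).toReal := by
        rw [integral_const_mul, integral_norm_eq_lintegral_enorm hK.1]

end WeakDerivative

/-! ### Duality formula for the area integrand -/

section Duality

variable {n : ℕ} {Ω : Set (EuclideanSpace ℝ (Fin n))}

/-- Almost everywhere approximation of integrable fields by `C_c¹(Ω)` fields: approximate in `L¹`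
by continuous fields, pass to a subsequence, cut off along a compact exhaustion of `Ω`, and
regularise without enlarging the support. -/
theorem exists_seq_contDiff_tendsto_ae (hΩ : IsOpen Ω) {m : Measure (EuclideanSpace ℝ (Fin n))}
    [IsFiniteMeasure m] (hm : m Ωᶜ = 0)
    {f : EuclideanSpace ℝ (Fin n) → EuclideanSpace ℝ (Fin n)} (hf : Integrable f m) :
    ∃ φ : ℕ → EuclideanSpace ℝ (Fin n) → EuclideanSpace ℝ (Fin n),
      (∀ j, ContDiff ℝ 1 (φ j) ∧ HasCompactSupport (φ j) ∧ tsupport (φ j) ⊆ Ω) ∧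
      ∀ᵐ x ∂m, Tendsto (fun j => φ j x) atTop (𝓝 (f x)) := by
  have hex : ∀ j : ℕ, ∃ h : EuclideanSpace ℝ (Fin n) → EuclideanSpace ℝ (Fin n),
      HasCompactSupport h ∧ eLpNorm (h - f) 1 m ≤ ((j : ℝ≥0∞) + 1)⁻¹ ∧ Continuous h := by
    intro j
    obtain ⟨h, hc, hle, hcont, -⟩ := hf.exists_hasCompactSupport_lintegral_sub_le
      (ε := ((j : ℝ≥0∞) + 1)⁻¹) (ENNReal.inv_ne_zero.2 (by finiteness))
    refine ⟨h, hc, ?_, hcont⟩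
    rwa [eLpNorm_sub_comm, eLpNorm_one_eq_lintegral_enorm]
  choose h hhc hhle hhcont using hex
  have hlim : Tendsto (fun j => eLpNorm (h j - f) 1 m) atTop (𝓝 0) := by
    refine tendsto_of_tendsto_of_tendsto_of_le_of_le tendsto_const_nhds
      ?_ (fun _ => zero_le) hhle
    have := (tendsto_add_atTop_iff_nat 1).2 ENNReal.tendsto_inv_nat_nhds_zero
    simpa using this
  obtain ⟨ns, -, hns⟩ := (tendstoInMeasure_of_tendsto_eLpNorm one_ne_zero
    (fun j => (hhcont j).aestronglyMeasurable) hf.1 hlim).exists_seq_tendsto_ae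
  obtain ⟨C, hCc, -, hCU, hCm⟩ := hΩ.exists_iUnion_isClosed
  let K : ℕ → Set (EuclideanSpace ℝ (Fin n)) := fun j => C j ∩ Metric.closedBall 0 j
  have hK : ∀ j, IsCompact (K j) := fun j => (isCompact_closedBall 0 (j : ℝ)).inter_left (hCc j)
  have hKΩ : ∀ j, K j ⊆ Ω := fun j =>
    Set.inter_subset_left.trans (hCU ▸ Set.subset_iUnion C j)
  have hKev : ∀ x ∈ Ω, ∀ᶠ j in atTop, x ∈ K j := by
    intro x hx
    rw [← hCU, Set.mem_iUnion] at hx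
    obtain ⟨i, hi⟩ := hx
    filter_upwards [eventually_ge_atTop i, eventually_ge_atTop ⌈‖x‖⌉₊] with j hj hj'
    refine ⟨hCm hj hi, ?_⟩
    rw [mem_closedBall_zero_iff]
    exact Nat.ceil_le.1 hj'
  choose χ hχ1 hχc hχs hχ using fun j =>
    exists_continuousMap_one_of_isCompact_subset_isOpen (hK j) hΩ (hKΩ j)
  have hφ : ∀ j : ℕ, ∃ φ : EuclideanSpace ℝ (Fin n) → EuclideanSpace ℝ (Fin n),
      ContDiff ℝ 1 φ ∧ (∀ x, dist (φ x) (χ j x • h (ns j) x) < 1 / ((j : ℝ) + 1)) ∧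
      Function.support φ ⊆ Function.support fun x => χ j x • h (ns j) x := fun j =>
    ((χ j).continuous.smul (hhcont (ns j))).exists_contDiff_approx 1 continuous_const
      fun _ => by positivity
  choose φ hφ1 hφ2 hφ3 using hφ
  have hsub : ∀ j, Function.support (φ j) ⊆ Function.support (χ j) := fun j =>
    fun x hx h => hφ3 j hx (by simp [h])
  refine ⟨φ, fun j => ⟨hφ1 j, HasCompactSupport.mono (hχc j) (hsub j),
    (closure_mono (hsub j)).trans (hχs j)⟩, ?_⟩
  have hmΩ : ∀ᵐ x ∂m, x ∈ Ω := by rw [ae_iff]; exact hm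
  filter_upwards [hns, hmΩ] with x hx hxΩ
  refine tendsto_of_tendsto_of_dist hx ?_
  refine squeeze_zero' (Eventually.of_forall fun _ => dist_nonneg) ?_
    tendsto_one_div_add_atTop_nhds_zero_nat
  filter_upwards [hKev x hxΩ] with j hj
  have := hφ2 j x
  rw [hχ1 j hj, Pi.one_apply, one_smul, dist_comm] at this
  exact this.le

/-- The radial diffeomorphism `z ↦ z / √(1 + |z|²)` onto the open unit ball. It turns unconstrained
test fields into fields bounded by one, and preserves smoothness and supports. -/
noncomputable def toBall (z : EuclideanSpace ℝ (Fin n)) : EuclideanSpace ℝ (Fin n) :=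
  (Real.sqrt (1 + ‖z‖ ^ 2))⁻¹ • z

theorem norm_toBall_sq (z : EuclideanSpace ℝ (Fin n)) :
    ‖toBall z‖ ^ 2 = ‖z‖ ^ 2 / (1 + ‖z‖ ^ 2) := by
  rw [toBall, norm_smul, mul_pow, norm_inv, Real.norm_of_nonneg (Real.sqrt_nonneg _), inv_pow,
    Real.sq_sqrt (by positivity), inv_mul_eq_div]

theorem norm_toBall_le (z : EuclideanSpace ℝ (Fin n)) : ‖toBall z‖ ≤ 1 := by
  have h : ‖toBall z‖ ^ 2 ≤ 1 := by
    rw [norm_toBall_sq, div_le_one (by positivity)]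
    linarith
  exact (sq_le_one_iff₀ (norm_nonneg _)).1 h

theorem sqrt_one_sub_norm_toBall (z : EuclideanSpace ℝ (Fin n)) :
    Real.sqrt (1 - ‖toBall z‖ ^ 2) = (Real.sqrt (1 + ‖z‖ ^ 2))⁻¹ := by
  rw [norm_toBall_sq, ← Real.sqrt_inv]
  congr 1
  field_simp
  ring

theorem contDiff_toBall : ContDiff ℝ 1 (toBall (n := n)) := by
  have h1 : ContDiff ℝ 1 fun z : EuclideanSpace ℝ (Fin n) => 1 + ‖z‖ ^ 2 :=
    contDiff_const.add (contDiff_norm_sq ℝ)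
  have h2 := h1.sqrt (fun z => by positivity)
  exact (h2.inv fun z => by positivity).smul contDiff_id

/-- An integrable bound, uniform in `z`, for the functional
`g ↦ a √(1 - |g|²) + g · p` at `g = toBall z`; its maximum over the unit ball is `√(a² + |p|²)`. -/
theorem toBall_pairing_abs_le {a : ℝ} (ha : 0 ≤ a) (z p : EuclideanSpace ℝ (Fin n)) :
    ‖a * Real.sqrt (1 - ‖toBall z‖ ^ 2) + inner ℝ (toBall z) p‖ ≤ a + ‖p‖ := by
  refine (norm_add_le _ _).trans (add_le_add ?_ ?_)
  · rw [norm_mul, Real.norm_of_nonneg ha, Real.norm_of_nonneg (Real.sqrt_nonneg _)]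
    refine mul_le_of_le_one_right ha (Real.sqrt_le_one.2 ?_)
    have := sq_nonneg ‖toBall z‖
    linarith
  · refine (norm_inner_le_norm _ _).trans ?_
    simpa using mul_le_mul_of_nonneg_right (norm_toBall_le z) (norm_nonneg p)

/-- The point `z = p / (a + δ)` maximises `a √(1 - |g|²) + g · p` over `g = toBall z` up to `δ`.
The exact maximiser `p / a` is not available where `a = 0`, that is, on the singular part. -/
theorem sqrt_le_toBall_pairing {a δ : ℝ} (ha : 0 ≤ a) (hδ : 0 < δ)
    (p : EuclideanSpace ℝ (Fin n)) :
    Real.sqrt (a ^ 2 + ‖p‖ ^ 2) - δ ≤ a * Real.sqrt (1 - ‖toBall ((a + δ)⁻¹ • p)‖ ^ 2) +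
      inner ℝ (toBall ((a + δ)⁻¹ • p)) p := by
  have hc : 0 < a + δ := by linarith
  set R := Real.sqrt ((a + δ) ^ 2 + ‖p‖ ^ 2) with hR
  have hRpos : 0 < R := Real.sqrt_pos.2 (by positivity)
  have hR2 : R ^ 2 = (a + δ) ^ 2 + ‖p‖ ^ 2 := Real.sq_sqrt (by positivity)
  have hRc : a + δ ≤ R := Real.le_sqrt_of_sq_le (by nlinarith [sq_nonneg ‖p‖])
  have hs : Real.sqrt (1 + ‖(a + δ)⁻¹ • p‖ ^ 2) = R / (a + δ) := by
    rw [hR, Real.sqrt_eq_iff_mul_self_eq (by positivity) (by positivity), ← hR, ← sq, div_pow, hR2,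
      norm_smul, norm_inv, Real.norm_of_nonneg hc.le]
    field_simp
  rw [sqrt_one_sub_norm_toBall, toBall, hs, inner_smul_left, inner_smul_left,
    real_inner_self_eq_norm_sq]
  simp only [conj_trivial]
  have hle : Real.sqrt (a ^ 2 + ‖p‖ ^ 2) ≤ R := Real.sqrt_le_sqrt (by nlinarith)
  have hval : a * (R / (a + δ))⁻¹ + (R / (a + δ))⁻¹ * ((a + δ)⁻¹ * ‖p‖ ^ 2) =
      R - δ * ((a + δ) / R) := by
    field_simp
    rw [hR2]
    ring
  rw [hval]
  have : δ * ((a + δ) / R) ≤ δ * 1 :=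
    mul_le_mul_of_nonneg_left ((div_le_one hRpos).2 hRc) hδ.le
  linarith

theorem integrable_sqrt_sq_add_sq {m : Measure (EuclideanSpace ℝ (Fin n))}
    {a : EuclideanSpace ℝ (Fin n) → ℝ} (ha : Integrable a m)
    {p : EuclideanSpace ℝ (Fin n) → EuclideanSpace ℝ (Fin n)} (hp : Integrable p m) :
    Integrable (fun x => Real.sqrt (a x ^ 2 + ‖p x‖ ^ 2)) m := by
  refine (ha.abs.add hp.norm).mono' ?_ (ae_of_all _ fun x => ?_)
  · exact (by fun_prop : Continuous fun y : ℝ × ℝ =>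
      Real.sqrt (y.1 ^ 2 + y.2 ^ 2)).comp_aestronglyMeasurable (ha.1.prodMk hp.1.norm)
  · rw [Real.norm_of_nonneg (Real.sqrt_nonneg _)]
    simp only [Pi.add_apply]
    refine Real.sqrt_le_iff.2 ⟨by positivity, ?_⟩
    nlinarith [sq_abs (a x), mul_nonneg (abs_nonneg (a x)) (norm_nonneg (p x))]

/-- The duality formula for the area integrand: for a finite measure `m` on `Ω` and densities
`(a, p)`, the integral of `√(a² + |p|²)` is attained up to `ε` by a test field `g` of `C_c¹(Ω)`. -/
theorem exists_test_field (hΩ : IsOpen Ω) {m : Measure (EuclideanSpace ℝ (Fin n))}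
    [IsFiniteMeasure m] (hm : m Ωᶜ = 0) {a : EuclideanSpace ℝ (Fin n) → ℝ}
    (ham : Integrable a m) (ha : ∀ x, 0 ≤ a x)
    {p : EuclideanSpace ℝ (Fin n) → EuclideanSpace ℝ (Fin n)} (hp : Integrable p m)
    {ε : ℝ} (hε : 0 < ε) :
    ∃ g : EuclideanSpace ℝ (Fin n) → EuclideanSpace ℝ (Fin n),
      ContDiff ℝ 1 g ∧ HasCompactSupport g ∧ tsupport g ⊆ Ω ∧ (∀ x, ‖g x‖ ≤ 1) ∧
      ∫ x, Real.sqrt (a x ^ 2 + ‖p x‖ ^ 2) ∂m ≤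
        ∫ x, (a x * Real.sqrt (1 - ‖g x‖ ^ 2) + inner ℝ (g x) (p x)) ∂m + ε := by
  -- Half of `ε` pays for `z = p / (a + δ)` not being the exact maximiser, the other half for
  -- replacing `z` by a smooth field.
  set δ : ℝ := ε / (2 * (m.real Set.univ + 1)) with hδdef
  have hmr : 0 ≤ m.real Set.univ := measureReal_nonneg
  have hδ : 0 < δ := by positivity
  have hδm : δ * m.real Set.univ ≤ ε / 2 := by
    rw [hδdef, div_mul_eq_mul_div, div_le_div_iff₀ (by positivity) (by positivity)]
    nlinarith
  have hsm : AEStronglyMeasurable (fun x => (a x + δ)⁻¹) m :=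
    (ham.1.aemeasurable.add_const δ).inv.aestronglyMeasurable
  have hz : Integrable (fun x => (a x + δ)⁻¹ • p x) m := by
    refine (hp.norm.const_mul δ⁻¹).mono' (hsm.smul hp.1) (ae_of_all _ fun x => ?_)
    have h1 := ha x
    rw [norm_smul, norm_inv, Real.norm_of_nonneg (by linarith)]
    gcongr
    linarith
  obtain ⟨φ, hφ, hlim⟩ := exists_seq_contDiff_tendsto_ae hΩ hm hz
  let G : EuclideanSpace ℝ (Fin n) → EuclideanSpace ℝ (Fin n) → ℝ := fun x z =>
    a x * Real.sqrt (1 - ‖toBall z‖ ^ 2) + inner ℝ (toBall z) (p x)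
  have hGc : ∀ x, Continuous (G x) := fun x => by
    have := contDiff_toBall (n := n).continuous
    fun_prop
  have hGm : ∀ z : EuclideanSpace ℝ (Fin n) → EuclideanSpace ℝ (Fin n),
      AEStronglyMeasurable z m → AEStronglyMeasurable (fun x => G x (z x)) m := by
    intro z hz
    have h1 : AEStronglyMeasurable (fun x => toBall (z x)) m :=
      contDiff_toBall.continuous.comp_aestronglyMeasurable hz
    refine (ham.1.mul ?_).add (h1.inner hp.1)
    exact (by fun_prop : Continuous fun y : EuclideanSpace ℝ (Fin n) =>
      Real.sqrt (1 - ‖y‖ ^ 2)).comp_aestronglyMeasurable h1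
  have hbd : Integrable (fun x => a x + ‖p x‖) m := ham.add hp.norm
  have hGb : ∀ x z, ‖G x z‖ ≤ a x + ‖p x‖ := fun x z => toBall_pairing_abs_le (ha x) z (p x)
  have hT : Tendsto (fun j => ∫ x, G x (φ j x) ∂m) atTop
      (𝓝 (∫ x, G x ((a x + δ)⁻¹ • p x) ∂m)) := by
    refine tendsto_integral_of_dominated_convergence _ (fun j => ?_) hbd
      (fun j => ae_of_all _ fun x => hGb x _) ?_
    · exact hGm _ (hφ j).1.continuous.aestronglyMeasurable
    · filter_upwards [hlim] with x hx using ((hGc x).tendsto _).comp hx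
  have hsq := integrable_sqrt_sq_add_sq ham hp
  have hopt : ∫ x, Real.sqrt (a x ^ 2 + ‖p x‖ ^ 2) ∂m - ε / 2 ≤
      ∫ x, G x ((a x + δ)⁻¹ • p x) ∂m := by
    calc ∫ x, Real.sqrt (a x ^ 2 + ‖p x‖ ^ 2) ∂m - ε / 2
        ≤ ∫ x, Real.sqrt (a x ^ 2 + ‖p x‖ ^ 2) ∂m - δ * m.real Set.univ := by linarith
      _ = ∫ x, (Real.sqrt (a x ^ 2 + ‖p x‖ ^ 2) - δ) ∂m := by
          rw [integral_sub hsq (integrable_const _), integral_const, smul_eq_mul, mul_comm]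
      _ ≤ _ := integral_mono (hsq.sub (integrable_const _))
          (hbd.mono' (hGm _ hz.1) (ae_of_all _ fun x => hGb x _))
          fun x => sqrt_le_toBall_pairing (ha x) hδ (p x)
  obtain ⟨j, hj⟩ := (hT.eventually (lt_mem_nhds
    (show _ < ∫ x, G x ((a x + δ)⁻¹ • p x) ∂m by linarith [hopt] :
      ∫ x, Real.sqrt (a x ^ 2 + ‖p x‖ ^ 2) ∂m - ε < _))).exists
  have hsub : Function.support (fun x => toBall (φ j x)) ⊆ Function.support (φ j) :=
    fun x hx h => hx (by simp [toBall, h])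
  refine ⟨fun x => toBall (φ j x), contDiff_toBall.comp (hφ j).1, (hφ j).2.1.mono hsub,
    (closure_mono hsub).trans (hφ j).2.2, fun x => norm_toBall_le _, ?_⟩
  have : ∫ x, Real.sqrt (a x ^ 2 + ‖p x‖ ^ 2) ∂m - ε < ∫ x, G x (φ j x) ∂m := hj
  simp only [G] at this
  linarith

end Duality

/-! ### Strict convexity of the area integrand -/

section AreaIntegrand

theorem sqrt_one_add_sq_le_add {E : Type*} [NormedAddCommGroup E] (p q : E) :
    Real.sqrt (1 + ‖p‖ ^ 2) ≤ Real.sqrt (1 + ‖q‖ ^ 2) + ‖p - q‖ := by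
  have h1 := Real.sq_sqrt (show (0 : ℝ) ≤ 1 + ‖q‖ ^ 2 by positivity)
  have h2 : ‖q‖ ≤ Real.sqrt (1 + ‖q‖ ^ 2) := Real.le_sqrt_of_sq_le (by linarith)
  have h3 : ‖p‖ ≤ ‖q‖ + ‖p - q‖ := by
    simpa using norm_add_le q (p - q)
  refine Real.sqrt_le_iff.2 ⟨by positivity, ?_⟩
  nlinarith [norm_nonneg (p - q), norm_nonneg p, norm_nonneg q,
    mul_le_mul_of_nonneg_right h2 (norm_nonneg (p - q))]

theorem norm_le_sqrt_one_add_sq {E : Type*} [NormedAddCommGroup E] (p : E) :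
    ‖p‖ ≤ Real.sqrt (1 + ‖p‖ ^ 2) :=
  Real.le_sqrt_of_sq_le (by linarith)

variable {E : Type*} [NormedAddCommGroup E] [InnerProductSpace ℝ E]

/-- Cauchy–Schwarz for `(√(1 - |g|²), g)` and `(c, p)`. -/
theorem mul_sqrt_add_inner_le {g : E} (hg : ‖g‖ ≤ 1) (c : ℝ) (p : E) :
    c * Real.sqrt (1 - ‖g‖ ^ 2) + inner ℝ g p ≤ Real.sqrt (c ^ 2 + ‖p‖ ^ 2) := by
  have h1 : 0 ≤ 1 - ‖g‖ ^ 2 := by nlinarith [norm_nonneg g]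
  have h2 := Real.sq_sqrt h1
  have h3 : inner ℝ g p ≤ ‖g‖ * ‖p‖ := real_inner_le_norm g p
  refine (add_le_add_right h3 _).trans (Real.le_sqrt_of_sq_le ?_)
  nlinarith [sq_nonneg (c * ‖g‖ - ‖p‖ * Real.sqrt (1 - ‖g‖ ^ 2))]

/-- The midpoint convexity defect of the area integrand, which is the defect in the triangle
inequality for `(1, p)` and `(1, q)`. -/
noncomputable def areaDefect (p q : E) : ℝ :=
  Real.sqrt (1 + ‖p‖ ^ 2) + Real.sqrt (1 + ‖q‖ ^ 2) - Real.sqrt (2 ^ 2 + ‖p + q‖ ^ 2)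

/-- Quantitative strict convexity: with `α = E(p)`, `β = E(q)` the defect is at least
`|p - q|² / (2αβ(α + β))`. -/
theorem sq_le_areaDefect_mul (p q : E) :
    ‖p - q‖ ^ 2 ≤ areaDefect p q * (2 * (Real.sqrt (1 + ‖p‖ ^ 2) * Real.sqrt (1 + ‖q‖ ^ 2)) *
      (Real.sqrt (1 + ‖p‖ ^ 2) + Real.sqrt (1 + ‖q‖ ^ 2))) ∧ 0 ≤ areaDefect p q := by
  have hp := Real.sq_sqrt (show (0 : ℝ) ≤ 1 + ‖p‖ ^ 2 by positivity)
  have hq := Real.sq_sqrt (show (0 : ℝ) ≤ 1 + ‖q‖ ^ 2 by positivity)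
  have hr := Real.sq_sqrt (show (0 : ℝ) ≤ 2 ^ 2 + ‖p + q‖ ^ 2 by positivity)
  have hpq := abs_real_inner_le_norm p q
  unfold areaDefect
  have hα : 1 ≤ Real.sqrt (1 + ‖p‖ ^ 2) := Real.one_le_sqrt.2 (by nlinarith [norm_nonneg p])
  have hβ : 1 ≤ Real.sqrt (1 + ‖q‖ ^ 2) := Real.one_le_sqrt.2 (by nlinarith [norm_nonneg q])
  have hγ : 0 ≤ Real.sqrt (2 ^ 2 + ‖p + q‖ ^ 2) := Real.sqrt_nonneg _
  set α := Real.sqrt (1 + ‖p‖ ^ 2)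
  set β := Real.sqrt (1 + ‖q‖ ^ 2)
  set γ := Real.sqrt (2 ^ 2 + ‖p + q‖ ^ 2)
  rw [norm_add_sq_real] at hr
  rw [norm_sub_sq_real]
  set i : ℝ := inner ℝ p q
  have hi2 : i ^ 2 ≤ ‖p‖ ^ 2 * ‖q‖ ^ 2 := by
    rw [← mul_pow, ← sq_abs i]
    exact pow_le_pow_left₀ (abs_nonneg _) hpq 2
  have hαβ : (α * β) ^ 2 = (1 + ‖p‖ ^ 2) * (1 + ‖q‖ ^ 2) := by rw [mul_pow, hp, hq]
  -- Lagrange's identity for `(1, p)` and `(1, q)`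
  have hlag : ‖p‖ ^ 2 - 2 * i + ‖q‖ ^ 2 ≤ (α * β - (1 + i)) * (α * β + (1 + i)) := by
    nlinarith
  have hle : |1 + i| ≤ α * β := by
    refine abs_le_of_sq_le_sq ?_ (by positivity)
    have : 0 ≤ ‖p‖ ^ 2 - 2 * i + ‖q‖ ^ 2 := by
      rw [← norm_sub_sq_real]
      exact sq_nonneg _
    nlinarith
  have hle1 := (abs_le.1 hle).1
  have hle2 := (abs_le.1 hle).2
  have hsq : (α + β - γ) * (α + β + γ) = 2 * (α * β - (1 + i)) := by nlinarith
  have hnn : 0 ≤ α + β - γ := by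
    by_contra h
    push Not at h
    nlinarith [mul_pos_of_neg_of_neg h (show -(α + β + γ) < 0 by linarith)]
  refine ⟨?_, hnn⟩
  have h1 : 2 * (α * β - (1 + i)) ≤ (α + β - γ) * (2 * (α + β)) := by
    rw [← hsq]
    exact mul_le_mul_of_nonneg_left (by linarith) hnn
  have h2 : (α * β - (1 + i)) * (α * β + (1 + i)) ≤ (α * β - (1 + i)) * (2 * (α * β)) :=
    mul_le_mul_of_nonneg_left (by linarith) (by linarith)
  have h3 : 0 ≤ α * β := by positivity
  nlinarith [mul_le_mul_of_nonneg_right h1 h3]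

/-- Uniform strict convexity of the area integrand: where the slope `q` is bounded, the excess
`|p - q| - E(p) + E(q)` is controlled by the convexity defect up to a small constant. -/
theorem exists_excess_le {M δ : ℝ} (hM : 0 ≤ M) (hδ : 0 < δ) :
    ∃ C : ℝ, 0 ≤ C ∧ ∀ p q : E, Real.sqrt (1 + ‖q‖ ^ 2) ≤ M →
      ‖p - q‖ - Real.sqrt (1 + ‖p‖ ^ 2) + Real.sqrt (1 + ‖q‖ ^ 2) ≤
        2 * δ + C * areaDefect p q := by
  refine ⟨2 * M * (2 * ((M / δ + 1) * M) * (2 * (M / δ) + 1)), by positivity, fun p q hq => ?_⟩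
  obtain ⟨h1, h2⟩ := sq_le_areaDefect_mul p q
  have h3 := sqrt_one_add_sq_le_add p q
  have h4 : Real.sqrt (1 + ‖q‖ ^ 2) ≤ Real.sqrt (1 + ‖p‖ ^ 2) + ‖p - q‖ := by
    rw [norm_sub_rev]; exact sqrt_one_add_sq_le_add q p
  have hpα := norm_le_sqrt_one_add_sq p
  have hqβ := norm_le_sqrt_one_add_sq q
  have htri := norm_sub_le p q
  have hα0 : 0 ≤ Real.sqrt (1 + ‖p‖ ^ 2) := Real.sqrt_nonneg _
  have hβ0 : 0 ≤ Real.sqrt (1 + ‖q‖ ^ 2) := Real.sqrt_nonneg _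
  set α := Real.sqrt (1 + ‖p‖ ^ 2)
  set β := Real.sqrt (1 + ‖q‖ ^ 2)
  set d := ‖p - q‖
  set D := areaDefect p q
  -- If `d ≤ δ`, the Lipschitz bound suffices. If `d ≥ δ`, then `E(p) ≲ d`, so `d²` cancels in the
  -- quantitative strict convexity and the defect is bounded below.
  rcases le_total d δ with hd | hd
  · have : 0 ≤ 2 * M * (2 * ((M / δ + 1) * M) * (2 * (M / δ) + 1)) * D := by positivity
    linarith
  · have hd0 : 0 < d := hδ.trans_le hd
    have hMd : M ≤ M / δ * d := by
      rw [div_mul_eq_mul_div, le_div_iff₀ hδ]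
      exact mul_le_mul_of_nonneg_left hd hM
    have hαd : α ≤ (M / δ + 1) * d := by linarith
    have hsum : α + β ≤ (2 * (M / δ) + 1) * d := by linarith
    have hK : 2 * (α * β) * (α + β) ≤
        2 * (((M / δ + 1) * d) * M) * ((2 * (M / δ) + 1) * d) := by gcongr
    have h5 : d ^ 2 * 1 ≤ d ^ 2 * (2 * ((M / δ + 1) * M) * (2 * (M / δ) + 1) * D) := by
      calc d ^ 2 * 1 ≤ D * (2 * (α * β) * (α + β)) := by linarith
        _ ≤ D * (2 * (((M / δ + 1) * d) * M) * ((2 * (M / δ) + 1) * d)) :=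
          mul_le_mul_of_nonneg_left hK h2
        _ = _ := by ring
    have h6 := le_of_mul_le_mul_left h5 (by positivity)
    have h7 : 2 * M * 1 ≤ 2 * M * (2 * ((M / δ + 1) * M) * (2 * (M / δ) + 1) * D) :=
      mul_le_mul_of_nonneg_left h6 (by positivity)
    linarith

end AreaIntegrand

/-! ### The area integral and test fields -/

section Decomposition

variable {n : ℕ} {Ω : Set (EuclideanSpace ℝ (Fin n))} {u v : EuclideanSpace ℝ (Fin n) → ℝ}

theorem integrable_approxGrad (Ω : Set (EuclideanSpace ℝ (Fin n)))
    (v : EuclideanSpace ℝ (Fin n) → ℝ) : Integrable (approxGrad Ω v) volume :=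
  Integrable.of_eval_piLp fun _ => SignedMeasure.integrable_rnDeriv _ _

theorem acDeriv_add_singDeriv (Ω : Set (EuclideanSpace ℝ (Fin n)))
    (v : EuclideanSpace ℝ (Fin n) → ℝ) : acDeriv Ω v + singDeriv Ω v = weakDeriv Ω v := by
  simp [singDeriv]

theorem component_singDeriv (Ω : Set (EuclideanSpace ℝ (Fin n)))
    (v : EuclideanSpace ℝ (Fin n) → ℝ) (k : Fin n) :
    component (singDeriv Ω v) k = (component (weakDeriv Ω v) k).singularPart volume := by
  have h := SignedMeasure.singularPart_add_withDensity_rnDeriv_eq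
    (s := component (weakDeriv Ω v) k) (μ := volume)
  rw [singDeriv, component_sub, acDeriv, component_withDensityᵥ (integrable_approxGrad Ω v)]
  exact (eq_sub_iff_add_eq.2 h).symm

/-- `Dˢv` is concentrated on a Lebesgue null set. -/
theorem exists_singular_set (Ω : Set (EuclideanSpace ℝ (Fin n)))
    (v : EuclideanSpace ℝ (Fin n) → ℝ) :
    ∃ S, MeasurableSet S ∧ volume S = 0 ∧ dominating (singDeriv Ω v) Sᶜ = 0 := by
  have h : ∀ k : Fin n, ∃ S, MeasurableSet S ∧ volume S = 0 ∧
      (component (singDeriv Ω v) k).totalVariation Sᶜ = 0 := by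
    intro k
    have h := SignedMeasure.mutuallySingular_singularPart (component (weakDeriv Ω v) k) volume
    rw [SignedMeasure.mutuallySingular_ennreal_iff,
      VectorMeasure.ennrealToMeasure_toENNRealVectorMeasure, ← component_singDeriv] at h
    obtain ⟨T, hT, h1, h2⟩ := h
    exact ⟨Tᶜ, hT.compl, h2, by simpa using h1⟩
  choose S hS h0 h1 using h
  refine ⟨⋃ k, S k, MeasurableSet.iUnion hS, measure_iUnion_null h0, ?_⟩
  rw [dominating, Measure.finsetSum_apply]
  exact Finset.sum_eq_zero fun k _ => measure_mono_null
    (Set.compl_subset_compl.2 (Set.subset_iUnion S k)) (h1 k)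

theorem integrableOn_sqrt (hΩb : volume Ω ≠ ∞) (c : ℝ)
    {p : EuclideanSpace ℝ (Fin n) → EuclideanSpace ℝ (Fin n)} (hp : Integrable p volume) :
    IntegrableOn (fun x => Real.sqrt (c ^ 2 + ‖p x‖ ^ 2)) Ω :=
  integrable_sqrt_sq_add_sq (integrableOn_const hΩb) hp.integrableOn

theorem integrableOn_sqrt_one (hΩb : volume Ω ≠ ∞)
    {p : EuclideanSpace ℝ (Fin n) → EuclideanSpace ℝ (Fin n)} (hp : Integrable p volume) :
    IntegrableOn (fun x => Real.sqrt (1 + ‖p x‖ ^ 2)) Ω := by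
  simpa using integrableOn_sqrt hΩb 1 hp

/-- The area integral is finite on sets of finite measure, so it can be treated as a real number. -/
theorem areaIntegral_toReal (hΩb : volume Ω ≠ ∞) (v : EuclideanSpace ℝ (Fin n) → ℝ) :
    areaIntegral Ω v ≠ ∞ ∧ (areaIntegral Ω v).toReal =
      (∫ x in Ω, Real.sqrt (1 + ‖approxGrad Ω v x‖ ^ 2)) +
        ((singDeriv Ω v).variation Ω).toReal := by
  have hi := integrableOn_sqrt_one hΩb (integrable_approxGrad Ω v)
  have h : ∫⁻ x in Ω, ENNReal.ofReal (Real.sqrt (1 + ‖approxGrad Ω v x‖ ^ 2)) =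
      ENNReal.ofReal (∫ x in Ω, Real.sqrt (1 + ‖approxGrad Ω v x‖ ^ 2)) :=
    (ofReal_integral_eq_lintegral_ofReal hi (ae_of_all _ fun _ => Real.sqrt_nonneg _)).symm
  have hf : (singDeriv Ω v).variation Ω ≠ ∞ := measure_ne_top _ _
  rw [areaIntegral, h]
  refine ⟨by finiteness, ?_⟩
  rw [ENNReal.toReal_add (by finiteness) hf, ENNReal.toReal_ofReal]
  exact integral_nonneg_of_ae (ae_of_all _ fun _ => Real.sqrt_nonneg _)

variable {g : EuclideanSpace ℝ (Fin n) → EuclideanSpace ℝ (Fin n)}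

theorem pairing_weakDeriv (hg : Continuous g) (hg1 : ∀ x, ‖g x‖ ≤ 1) (hs : tsupport g ⊆ Ω)
    (v : EuclideanSpace ℝ (Fin n) → ℝ) :
    pairing g (weakDeriv Ω v) =
      (∫ x in Ω, inner ℝ (g x) (approxGrad Ω v x)) + pairing g (singDeriv Ω v) := by
  rw [← acDeriv_add_singDeriv, pairing_add hg hg1, acDeriv,
    pairing_withDensityᵥ_eq_setIntegral hg hg1 (integrable_approxGrad Ω v) hs]

/-- The area `∫_Ω E(Dv)` is the total variation of the `ℝ × ℝⁿ`-valued measure `(ℒⁿ, Dv)`, and is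
attained up to `ε` by the field `(√(1 - |g|²), g)` for some test field `g`. -/
theorem exists_area_test_field (hΩ : IsOpen Ω) (hΩb : volume Ω ≠ ∞)
    (v : EuclideanSpace ℝ (Fin n) → ℝ) {ε : ℝ} (hε : 0 < ε) :
    ∃ g : EuclideanSpace ℝ (Fin n) → EuclideanSpace ℝ (Fin n),
      ContDiff ℝ 1 g ∧ HasCompactSupport g ∧ tsupport g ⊆ Ω ∧ (∀ x, ‖g x‖ ≤ 1) ∧
      (areaIntegral Ω v).toReal ≤
        (∫ x in Ω, Real.sqrt (1 - ‖g x‖ ^ 2)) + pairing g (weakDeriv Ω v) + ε := by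
  classical
  obtain ⟨S, hS, hS0, hSc⟩ := exists_singular_set Ω v
  obtain ⟨s, hs, hsv⟩ := exists_density (singDeriv Ω v)
  set τ := (dominating (singDeriv Ω v)).restrict Ω with hτ
  set l := (volume : Measure (EuclideanSpace ℝ (Fin n))).restrict Ω with hl
  have hlf : IsFiniteMeasure l := ⟨by simpa [hl] using hΩb.lt_top⟩
  set q := approxGrad Ω v
  have hq : Integrable q l := (integrable_approxGrad Ω v).integrableOn
  have hs' : Integrable s τ := hs.integrableOn
  have hlS : ∀ᵐ x ∂l, x ∉ S := by
    refine ae_restrict_of_ae ?_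
    rw [ae_iff]; simpa using hS0
  have hτS : ∀ᵐ x ∂τ, x ∈ S := by
    refine ae_restrict_of_ae ?_
    rw [ae_iff]; exact hSc
  -- `(a, p)` is the density of `(ℒⁿ, Dv)` with respect to `l + τ`: on the null set `S`, where
  -- `Dˢv` lives, it is `(0, s)`, and off `S` it is `(1, ∇v)`.
  let a : EuclideanSpace ℝ (Fin n) → ℝ := Sᶜ.indicator fun _ => 1
  let p : EuclideanSpace ℝ (Fin n) → EuclideanSpace ℝ (Fin n) := S.piecewise s q
  have hal : a =ᵐ[l] fun _ => 1 := by
    filter_upwards [hlS] with x hx using by simp [a, hx]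
  have haτ : a =ᵐ[τ] fun _ => 0 := by
    filter_upwards [hτS] with x hx using by simp [a, hx]
  have hpl : p =ᵐ[l] q := by
    filter_upwards [hlS] with x hx using by simp [p, hx]
  have hpτ : p =ᵐ[τ] s := by
    filter_upwards [hτS] with x hx using by simp [p, hx]
  have ha : ∀ x, 0 ≤ a x := fun x => Set.indicator_nonneg (fun _ _ => zero_le_one) x
  have ham : Integrable a (l + τ) :=
    (integrable_const (1 : ℝ)).indicator hS.compl
  have hp : Integrable p (l + τ) :=
    integrable_add_measure.2 ⟨hq.congr hpl.symm, hs'.congr hpτ.symm⟩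
  have hm : (l + τ) Ωᶜ = 0 := by
    simp [hl, hτ, Measure.restrict_apply hΩ.measurableSet.compl]
  obtain ⟨g, hg, hgc, hgs, hg1, hle⟩ := exists_test_field hΩ hm ham ha hp hε
  refine ⟨g, hg, hgc, hgs, hg1, ?_⟩
  have hsq := integrable_add_measure.1 (integrable_sqrt_sq_add_sq ham hp)
  have hsv' : ((singDeriv Ω v).variation Ω).toReal = ∫ x, ‖s x‖ ∂τ := by
    conv_lhs => rw [← hsv]
    exact variation_withDensityᵥ_toReal hs hΩ.measurableSet
  have hpg : pairing g (singDeriv Ω v) = ∫ x, inner ℝ (g x) (s x) ∂τ := by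
    conv_lhs => rw [← hsv]
    exact pairing_withDensityᵥ_eq_setIntegral hg.continuous hg1 hs hgs
  have hL : ∫ x, Real.sqrt (a x ^ 2 + ‖p x‖ ^ 2) ∂(l + τ) =
      (∫ x, Real.sqrt (1 + ‖q x‖ ^ 2) ∂l) + ∫ x, ‖s x‖ ∂τ := by
    rw [integral_add_measure hsq.1 hsq.2]
    congr 1
    · refine integral_congr_ae ?_
      filter_upwards [hal, hpl] with x h1 h2
      rw [h1, h2, one_pow]
    · refine integral_congr_ae ?_
      filter_upwards [haτ, hpτ] with x h1 h2
      rw [h1, h2, zero_pow two_ne_zero, zero_add, Real.sqrt_sq (norm_nonneg _)]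
  have hgsq : Continuous fun x => Real.sqrt (1 - ‖g x‖ ^ 2) := by
    have := hg.continuous
    fun_prop
  have hgsq1 : ∀ x, ‖Real.sqrt (1 - ‖g x‖ ^ 2)‖ ≤ 1 := fun x => by
    rw [Real.norm_of_nonneg (Real.sqrt_nonneg _)]
    exact Real.sqrt_le_one.2 (by linarith [sq_nonneg ‖g x‖])
  have hi := integrable_add_measure.1
    ((ham.mul_bdd hgsq.aestronglyMeasurable (ae_of_all _ hgsq1)).fun_add
      (integrable_inner_of_le_one hg.continuous hg1 hp))
  have hR : ∫ x, (a x * Real.sqrt (1 - ‖g x‖ ^ 2) + inner ℝ (g x) (p x)) ∂(l + τ) =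
      (∫ x, Real.sqrt (1 - ‖g x‖ ^ 2) ∂l) + (∫ x, inner ℝ (g x) (q x) ∂l) +
        ∫ x, inner ℝ (g x) (s x) ∂τ := by
    rw [integral_add_measure hi.1 hi.2]
    congr 1
    · rw [← integral_add ((integrable_const (1 : ℝ)).mono' hgsq.aestronglyMeasurable
        (ae_of_all _ hgsq1)) (integrable_inner_of_le_one hg.continuous hg1 hq)]
      refine integral_congr_ae ?_
      filter_upwards [hal, hpl] with x h1 h2
      simp only [h1, h2, one_mul]
    · refine integral_congr_ae ?_
      filter_upwards [haτ, hpτ] with x h1 h2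
      simp only [h1, h2, zero_mul, zero_add]
  rw [hL, hR] at hle
  rw [(areaIntegral_toReal hΩb v).2, pairing_weakDeriv hg.continuous hg1 hgs, hsv', hpg]
  linarith

/-- Each test field bounds from below the area of `(Dv + Dw) / 2` (doubled). -/
theorem test_field_le (hΩ : IsOpen Ω) (hΩb : volume Ω ≠ ∞) (v w : EuclideanSpace ℝ (Fin n) → ℝ)
    (hg : Continuous g) (hg1 : ∀ x, ‖g x‖ ≤ 1) (hs : tsupport g ⊆ Ω) :
    2 * (∫ x in Ω, Real.sqrt (1 - ‖g x‖ ^ 2)) + pairing g (weakDeriv Ω v) +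
        pairing g (weakDeriv Ω w) ≤
      (∫ x in Ω, Real.sqrt (2 ^ 2 + ‖approxGrad Ω v x + approxGrad Ω w x‖ ^ 2)) +
        ((singDeriv Ω v).variation Ω).toReal + ((singDeriv Ω w).variation Ω).toReal := by
  have hlf : IsFiniteMeasure (volume.restrict Ω) := ⟨by simpa using hΩb.lt_top⟩
  have hv := (integrable_approxGrad Ω v).integrableOn (s := Ω)
  have hw := (integrable_approxGrad Ω w).integrableOn (s := Ω)
  have hgi : IntegrableOn (fun x => Real.sqrt (1 - ‖g x‖ ^ 2)) Ω := by
    refine (integrable_const (1 : ℝ)).mono' (by fun_prop : Continuous _).aestronglyMeasurable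
      (ae_of_all _ fun x => ?_)
    rw [Real.norm_of_nonneg (Real.sqrt_nonneg _)]
    exact Real.sqrt_le_one.2 (by linarith [sq_nonneg ‖g x‖])
  have hiv := integrable_inner_of_le_one hg hg1 hv
  have hiw := integrable_inner_of_le_one hg hg1 hw
  have h1 : 2 * (∫ x in Ω, Real.sqrt (1 - ‖g x‖ ^ 2)) +
      (∫ x in Ω, inner ℝ (g x) (approxGrad Ω v x)) + (∫ x in Ω, inner ℝ (g x) (approxGrad Ω w x)) ≤
      ∫ x in Ω, Real.sqrt (2 ^ 2 + ‖approxGrad Ω v x + approxGrad Ω w x‖ ^ 2) := by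
    rw [← integral_const_mul, ← integral_add (hgi.const_mul 2) hiv,
      ← integral_add ((hgi.const_mul 2).fun_add hiv) hiw]
    refine integral_mono (((hgi.const_mul 2).add hiv).add hiw) (integrableOn_sqrt hΩb 2
      ((integrable_approxGrad Ω v).add (integrable_approxGrad Ω w))) fun x => ?_
    have := mul_sqrt_add_inner_le (hg1 x) 2 (approxGrad Ω v x + approxGrad Ω w x)
    rw [inner_add_right] at this
    linarith
  have h2 := pairing_le hg hg1 hΩ.measurableSet hs (singDeriv Ω v)
  have h3 := pairing_le hg hg1 hΩ.measurableSet hs (singDeriv Ω w)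
  rw [pairing_weakDeriv hg hg1 hs, pairing_weakDeriv hg hg1 hs]
  linarith

theorem variation_weakDeriv_sub_le (hΩ : IsOpen Ω) (hv : BVDot Ω v) (hu : BVDot Ω u) :
    (weakDeriv Ω fun x => v x - u x).variation Ω ≤
      ENNReal.ofReal ((∫ x in Ω, ‖approxGrad Ω v x - approxGrad Ω u x‖) +
        ((singDeriv Ω v).variation Ω).toReal + ((singDeriv Ω u).variation Ω).toReal) := by
  have hiv := integrable_approxGrad Ω v
  have hiu := integrable_approxGrad Ω u
  have hd : weakDeriv Ω (fun x => v x - u x) =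
      volume.withDensityᵥ (approxGrad Ω v - approxGrad Ω u) +
        (singDeriv Ω v - singDeriv Ω u) := by
    rw [weakDeriv_sub hΩ hv hu, withDensityᵥ_sub hiv hiu, singDeriv, singDeriv, acDeriv, acDeriv]
    abel
  rw [ENNReal.ofReal_add (by positivity) (by positivity),
    ENNReal.ofReal_add (by positivity) (by positivity),
    ENNReal.ofReal_toReal (measure_ne_top _ _), ENNReal.ofReal_toReal (measure_ne_top _ _), hd,
    add_assoc]
  refine (VectorMeasure.variation_add_le Ω).trans ?_
  rw [Measure.add_apply]
  refine add_le_add (le_of_eq ?_) (VectorMeasure.variation_sub_le Ω)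
  rw [← ENNReal.ofReal_toReal (measure_ne_top _ Ω),
    variation_withDensityᵥ_toReal (hiv.sub hiu) hΩ.measurableSet]
  rfl

end Decomposition

/-! ### Consequences of area-strict convergence -/

section AreaStrict

variable {n : ℕ} {Ω : Set (EuclideanSpace ℝ (Fin n))} {u : EuclideanSpace ℝ (Fin n) → ℝ}

theorem integrableOn_areaDefect (hΩb : volume Ω ≠ ∞) (v w : EuclideanSpace ℝ (Fin n) → ℝ) :
    IntegrableOn (fun x => areaDefect (approxGrad Ω v x) (approxGrad Ω w x)) Ω := by
  have hv := integrable_approxGrad Ω v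
  have hw := integrable_approxGrad Ω w
  exact ((integrableOn_sqrt_one hΩb hv).add (integrableOn_sqrt_one hΩb hw)).sub
    (integrableOn_sqrt hΩb 2 (hv.add hw))

theorem integral_areaDefect (hΩb : volume Ω ≠ ∞) (v w : EuclideanSpace ℝ (Fin n) → ℝ) :
    ∫ x in Ω, areaDefect (approxGrad Ω v x) (approxGrad Ω w x) =
      (∫ x in Ω, Real.sqrt (1 + ‖approxGrad Ω v x‖ ^ 2)) +
        (∫ x in Ω, Real.sqrt (1 + ‖approxGrad Ω w x‖ ^ 2)) -
        ∫ x in Ω, Real.sqrt (2 ^ 2 + ‖approxGrad Ω v x + approxGrad Ω w x‖ ^ 2) := by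
  have hv := integrable_approxGrad Ω v
  have hw := integrable_approxGrad Ω w
  rw [← integral_add (integrableOn_sqrt_one hΩb hv) (integrableOn_sqrt_one hΩb hw),
    ← integral_sub ((integrableOn_sqrt_one hΩb hv).fun_add (integrableOn_sqrt_one hΩb hw))
      (integrableOn_sqrt hΩb 2 (hv.fun_add hw))]
  rfl

/-- Under area-strict convergence the convexity defect between `∇u_t` and `∇u` tends to zero. -/
theorem eventually_integral_areaDefect_le (hΩ : IsOpen Ω) (hΩb : volume Ω ≠ ∞)
    {U : ℝ → EuclideanSpace ℝ (Fin n) → ℝ} (hU : ∀ t : ℝ, 0 < t → BVDot Ω (U t))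
    (hu : BVDot Ω u) (hconv : TendstoAreaStrictly Ω U u) {ε : ℝ} (hε : 0 < ε) :
    ∀ᶠ t in atTop, ∫ x in Ω, areaDefect (approxGrad Ω (U t) x) (approxGrad Ω u x) ≤ ε := by
  obtain ⟨g, hg, hgc, hgs, hg1, hle⟩ := exists_area_test_field hΩ hΩb u
    (show 0 < ε / 4 by positivity)
  have hA := (ENNReal.tendsto_toReal (areaIntegral_toReal hΩb u).1).comp hconv.2
  have hP := tendsto_pairing hΩ hU hu hconv.1 hg hgc hgs
  have hlim := hA.sub hP
  filter_upwards [hlim.eventually (gt_mem_nhds (lt_add_of_pos_right _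
    (show 0 < ε / 2 by positivity)))] with t ht
  have h1 := test_field_le hΩ hΩb (U t) u hg.continuous hg1 hgs
  rw [integral_areaDefect hΩb]
  simp only [Function.comp_apply] at ht
  rw [(areaIntegral_toReal hΩb (U t)).2] at ht
  rw [(areaIntegral_toReal hΩb u).2] at ht hle
  linarith

/-- The integral of `f` over `{f > M}` is small for large `M`. -/
theorem exists_tail_le {f : EuclideanSpace ℝ (Fin n) → ℝ} (hf : IntegrableOn f Ω)
    {η : ℝ} (hη : 0 < η) :
    ∃ M : ℝ, 0 ≤ M ∧ ∫ x in Ω, (if f x ≤ M then 0 else f x) ≤ η := by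
  have hT : Tendsto (fun j : ℕ => ∫ x in Ω, (if f x ≤ j then 0 else f x)) atTop
      (𝓝 (∫ x in Ω, (0 : ℝ))) := by
    refine tendsto_integral_of_dominated_convergence (fun x => ‖f x‖) (fun j => ?_) hf.norm
      (fun j => ae_of_all _ fun x => ?_) (ae_of_all _ fun x => ?_)
    · exact (Measurable.ite (measurableSet_Iic (a := (j : ℝ))) measurable_const
        measurable_id).comp_aemeasurable hf.1.aemeasurable |>.aestronglyMeasurable
    · split_ifs <;> simp
    · refine tendsto_const_nhds.congr' ?_
      filter_upwards [eventually_ge_atTop ⌈f x⌉₊] with j hj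
      rw [if_pos (Nat.ceil_le.1 hj)]
  rw [integral_zero] at hT
  obtain ⟨j, hj⟩ := (hT.eventually (gt_mem_nhds hη)).exists
  exact ⟨j, j.cast_nonneg, hj.le⟩

/-- The excess `∫ |∇u_t - ∇u| - E(∇u_t) + E(∇u)` is asymptotically nonpositive. -/
theorem eventually_excess_le (hΩ : IsOpen Ω) (hΩb : volume Ω ≠ ∞)
    {U : ℝ → EuclideanSpace ℝ (Fin n) → ℝ} (hU : ∀ t : ℝ, 0 < t → BVDot Ω (U t))
    (hu : BVDot Ω u) (hconv : TendstoAreaStrictly Ω U u) {η : ℝ} (hη : 0 < η) :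
    ∀ᶠ t in atTop, (∫ x in Ω, ‖approxGrad Ω (U t) x - approxGrad Ω u x‖) -
      (∫ x in Ω, Real.sqrt (1 + ‖approxGrad Ω (U t) x‖ ^ 2)) +
      (∫ x in Ω, Real.sqrt (1 + ‖approxGrad Ω u x‖ ^ 2)) ≤ η := by
  have hlf : IsFiniteMeasure (volume.restrict Ω) := ⟨by simpa using hΩb.lt_top⟩
  have hq := integrable_approxGrad Ω u
  have hE := integrableOn_sqrt_one hΩb hq
  -- Where `E(∇u) ≤ M` the excess is controlled by the convexity defect; elsewhere it is at most
  -- `2 E(∇u)`, which has small integral.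
  obtain ⟨M, hM, htail⟩ := exists_tail_le hE (show 0 < η / 6 by positivity)
  have hvol : 0 ≤ volume.real Ω := measureReal_nonneg
  have hδ : 0 < η / (6 * (volume.real Ω + 1)) := by positivity
  have hδΩ : η / (6 * (volume.real Ω + 1)) * volume.real Ω ≤ η / 6 := by
    rw [div_mul_eq_mul_div, div_le_div_iff₀ (by positivity) (by positivity)]
    nlinarith
  obtain ⟨C, hC, hex⟩ := exists_excess_le (E := EuclideanSpace ℝ (Fin n)) hM hδ
  set δ := η / (6 * (volume.real Ω + 1))
  have hCη : C * (η / (3 * (C + 1))) ≤ η / 3 := by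
    rw [mul_div_assoc', div_le_div_iff₀ (by positivity) (by positivity)]
    nlinarith
  filter_upwards [eventually_integral_areaDefect_le hΩ hΩb hU hu hconv
    (show 0 < η / (3 * (C + 1)) by positivity)] with t ht
  have hp := integrable_approxGrad Ω (U t)
  have hEt := integrableOn_sqrt_one hΩb hp
  have hD := integrableOn_areaDefect hΩb (U t) u
  have hd : IntegrableOn (fun x => ‖approxGrad Ω (U t) x - approxGrad Ω u x‖) Ω :=
    (hp.sub hq).norm.integrableOn
  have hF : IntegrableOn (fun x => if Real.sqrt (1 + ‖approxGrad Ω u x‖ ^ 2) ≤ M then 0 else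
      Real.sqrt (1 + ‖approxGrad Ω u x‖ ^ 2)) Ω := by
    refine hE.mono' ?_ (ae_of_all _ fun x => ?_)
    · exact (Measurable.ite (measurableSet_Iic (a := M)) measurable_const
        measurable_id).comp_aemeasurable hE.1.aemeasurable |>.aestronglyMeasurable
    · split_ifs
      · simp
      · rw [Real.norm_of_nonneg (Real.sqrt_nonneg _)]
  calc _ = ∫ x in Ω, (‖approxGrad Ω (U t) x - approxGrad Ω u x‖ -
        Real.sqrt (1 + ‖approxGrad Ω (U t) x‖ ^ 2) +
        Real.sqrt (1 + ‖approxGrad Ω u x‖ ^ 2)) := by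
        rw [integral_add (hd.fun_sub hEt) hE, integral_sub hd hEt]
    _ ≤ ∫ x in Ω, (2 * δ + C * areaDefect (approxGrad Ω (U t) x) (approxGrad Ω u x) +
        2 * (if Real.sqrt (1 + ‖approxGrad Ω u x‖ ^ 2) ≤ M then 0 else
          Real.sqrt (1 + ‖approxGrad Ω u x‖ ^ 2))) := by
        refine integral_mono ((hd.sub hEt).add hE)
          (((integrable_const _).add (hD.const_mul C)).add (hF.const_mul 2)) fun x => ?_
        simp only
        split_ifs with h
        · simpa using hex (approxGrad Ω (U t) x) (approxGrad Ω u x) h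
        · have h1 := norm_le_sqrt_one_add_sq (approxGrad Ω (U t) x)
          have h2 := norm_le_sqrt_one_add_sq (approxGrad Ω u x)
          have h3 := norm_sub_le (approxGrad Ω (U t) x) (approxGrad Ω u x)
          have h4 := mul_nonneg hC (sq_le_areaDefect_mul (approxGrad Ω (U t) x)
            (approxGrad Ω u x)).2
          linarith
    _ = volume.real Ω * (2 * δ) +
        C * (∫ x in Ω, areaDefect (approxGrad Ω (U t) x) (approxGrad Ω u x)) +
        2 * ∫ x in Ω, (if Real.sqrt (1 + ‖approxGrad Ω u x‖ ^ 2) ≤ M then 0 else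
          Real.sqrt (1 + ‖approxGrad Ω u x‖ ^ 2)) := by
        rw [integral_add ((integrable_const _).fun_add (hD.const_mul C)) (hF.const_mul 2),
          integral_add (integrable_const _) (hD.const_mul C), integral_const, smul_eq_mul,
          measureReal_restrict_apply_univ, integral_const_mul, integral_const_mul]
    _ ≤ η := by
        have := mul_le_mul_of_nonneg_left ht hC
        linarith

end AreaStrict

end HomBV

theorem proposition3p3 (n : ℕ) (hn : 1 ≤ n) (Ω : Set (EuclideanSpace ℝ (Fin n)))
    (hΩ : IsOpen Ω) (hΩb : Bornology.IsBounded Ω) (hΩf : volume (frontier Ω) = 0)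
    (U : ℝ → EuclideanSpace ℝ (Fin n) → ℝ) (u : EuclideanSpace ℝ (Fin n) → ℝ)
    (hU : ∀ t : ℝ, 0 < t → HomBV.BVDot Ω (U t)) (hu : HomBV.BVDot Ω u)
    (hconv : HomBV.TendstoAreaStrictly Ω U u) :
    limsup (fun t : ℝ => (HomBV.weakDeriv Ω (fun x => U t x - u x)).variation Ω) atTop
      ≤ 2 * (HomBV.singDeriv Ω u).variation Ω := by
  have hvol : volume Ω ≠ ∞ := hΩb.measure_lt_top.ne
  refine ENNReal.le_of_forall_pos_le_add fun η hη _ => ?_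
  have hη' : (0 : ℝ) < η / 2 := by positivity
  have hA := (ENNReal.tendsto_toReal (HomBV.areaIntegral_toReal hvol u).1).comp hconv.2
  refine limsup_le_of_le (by isBoundedDefault) ?_
  filter_upwards [HomBV.eventually_excess_le hΩ hvol hU hu hconv hη',
    hA.eventually (gt_mem_nhds (lt_add_of_pos_right _ hη')), eventually_gt_atTop 0]
    with t h1 h2 ht
  refine (HomBV.variation_weakDeriv_sub_le hΩ (hU t ht) hu).trans ?_
  simp only [Function.comp_apply] at h2
  rw [(HomBV.areaIntegral_toReal hvol (U t)).2, (HomBV.areaIntegral_toReal hvol u).2] at h2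
  have hf : (HomBV.singDeriv Ω u).variation Ω ≠ ∞ := measure_ne_top _ _
  refine ENNReal.ofReal_le_of_le_toReal ?_
  rw [ENNReal.toReal_add (by finiteness) (by finiteness), ENNReal.toReal_mul]
  simp only [ENNReal.toReal_ofNat, ENNReal.coe_toReal]
  linarith
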